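/- **Notation.** Let $G$ be a finite group, and let $\Omega(G)=\mathbb{Q}\otimes_{\mathbb{Z}}\Omega_{\mathbb{Z}}(G)$ be its rational Burnside ring, where $\Omega_{\mathbb Z}(G)$ is the Grothendieck ring of finite $G$-sets (disjoint union, cartesian product). For $K\le G$ let $\varepsilon_K\in\Omega(G)$ be the primitive idempotent corresponding to $K$, i.e. the unique primitive idempotent on which the mark homomorphism $[X]\mapsto |X^K|$ takes the value $1$. For a finite category $\mathsf D$ with a $G$-action let $\mathsf D_n$ be the $G$-set of non-degenerate $n$-simplices of its nerve (chains of $n$ composable non-identity morphisms; $\mathsf D_0$ is the set of objects) and $f_{\mathsf D}(t)=\sum_{n\ge 0}[\mathsf D_n]t^n\in\Omega(G)[[t]]$. The category $\mathsf D$ has a series Lefschetz invariant if $f_{\mathsf D}\in\Omega(G)\otimes_{\mathbb Q}\mathbb{Q}[t]_{(t+1)}$, and then $\Lambda_\Sigma(\mathsf D)=f_{\mathsf D}(-1)$ and $\widetilde\Lambda_\Sigma(\mathsf D)=\Lambda_\Sigma(\mathsf D)-[G/G]$. For a finite poset (regarded as a finite category) $\widetilde\chi=\chi-1$, where $\chi$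 is the Euler characteristic, i.e. the sum of the values of any weighting, equivalently of any coweighting, of the category. Let $\mathscr S$ be a set of subgroups of $G$ closed under conjugation. For $H\le G$ put $\mathscr S_{>H}=\{K\in\mathscr S: K>H\}$ and $\mathscr S_{<H}=\{K\in\mathscr S: K<H\}$, whether or not $H\in\mathscr S$. The orbit category $\mathcal O_{\mathscr S}$ has object set $\mathscr S$, and its morphisms $H\to K$ are the $G$-maps $G/H\to G/K$. The fusion category $\mathcal F_{\mathscr S}$ has object set $\mathscr S$, and its morphisms $H\to K$ are the group homomorphisms $H\to K$ induced by conjugation by an element of $G$. For a functor $F$ from a finite category $\mathsf C$ to finite $G$-sets, the Grothendieck construction has as objects the pairs $(x,a)$ with $a\in F(x)$, as morphisms $(x,a)\to(y,b)$ the morphisms $\varphi:x\to y$ of $\mathsf C$ with $F(\varphi)(a)=b$, and $G$-action $g(x,a)=(x,ga)$. Let $E\mathcal O_{\mathscr S}$ be the Grothendieck construction of the inclusion $H\mapsto G/H$ on $\mathcal O_{\mathscr S}$. Let $E\mathcal A_{\mathscr S}$ be that of the functor $\mathcal F_{\mathscr S}^{\mathrm{op}}\to\{\text{finite } G\text{-sets}\}$,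 $K\mapsto G/C_G(K)$, which sends the conjugation $c_g:L\to K$, $x\mapsto gxg^{-1}$, to the $G$-map $G/C_G(K)\to G/C_G(L)$, $aC_G(K)\mapsto agC_G(L)$. **Theorem.** Both $E\mathcal O_{\mathscr S}$ and $E\mathcal A_{\mathscr S}$ have a series Lefschetz invariant, and in $\Omega(G)$ $$\widetilde\Lambda_\Sigma(E\mathcal O_{\mathscr S})=\sum_{H\in\mathscr S}\frac{-\widetilde\chi(\mathscr S_{>H})}{|G:H|}\,[G/H]-[G/G],$$ $$\widetilde\Lambda_\Sigma(E\mathcal A_{\mathscr S})=\sum_{H\in\mathscr S}\frac{-\widetilde\chi(\mathscr S_{<H})}{|G:C_G(H)|}\,[G/C_G(H)]-[G/G].$$ Moreover, for every set $[G\backslash\mathrm{Sub}(G)]$ of representatives of the conjugacy classes of subgroups of $G$, $$\widetilde\Lambda_\Sigma(E\mathcal O_{\mathscr S})=\sum_{\substack{K\in[G\backslash\mathrm{Sub}(G)]\\ K\notin\mathscr S}}\widetilde\chi(\mathscr S_{>K})\,\varepsilon_K,\qquad \widetilde\Lambda_\Sigma(E\mathcal A_{\mathscr S})=\sum_{\substack{K\in[G\backslash\mathrm{Sub}(G)]\\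 C_G(K)\notin\mathscr S}}\widetilde\chi(\mathscr S_{<C_G(K)})\,\varepsilon_K.$$ -/

import Mathlib

open CategoryTheory
open scoped Pointwise

universe u v

namespace SeriesLefschetz

noncomputable section

/-! ### Finite `G`-sets -/

/-- A finite (left) `G`-set. -/
structure FinGSet (G : Type u) [Group G] where
  carrier : Type u
  [action : MulAction G carrier]
  [finite : Finite carrier]

section GSets

variable {G : Type u} [Group G]

instance : CoeSort (FinGSet G) (Type u) := ⟨FinGSet.carrier⟩

instance (X : FinGSet G) : MulAction G X := X.action

instance (X : FinGSet G) : Finite X := X.finite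

/-- The category of finite `G`-sets and `G`-equivariant maps. -/
instance : Category (FinGSet G) where
  Hom X Y := X →[G] Y
  id X := MulActionHom.id G
  comp f g := MulActionHom.comp g f

/-- Bundle a finite type with a `G`-action. -/
abbrev FinGSet.of (X : Type u) [MulAction G X] [Finite X] : FinGSet G := ⟨X⟩

/-- The underlying set of a finite `G`-set. -/
def forgetGSet (G : Type u) [Group G] : FinGSet G ⥤ Type u where
  obj X := X
  map {X Y} f := TypeCat.ofHom (fun x : X => (show X →[G] Y from f) x)

/-- Two finite `G`-sets are isomorphic if there is an equivariant bijection between them. -/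
def FinGSet.Isom (X Y : FinGSet G) : Prop := ∃ e : X ≃ Y, ∀ (g : G) (x : X), e (g • x) = g • e x

theorem FinGSet.Isom.refl (X : FinGSet G) : X.Isom X := ⟨Equiv.refl _, fun _ _ => rfl⟩

theorem FinGSet.Isom.symm {X Y : FinGSet G} : X.Isom Y → Y.Isom X := by
  rintro ⟨e, he⟩
  exact ⟨e.symm, fun g y => by rw [Equiv.symm_apply_eq, he, Equiv.apply_symm_apply]⟩

theorem FinGSet.Isom.trans {X Y Z : FinGSet G} : X.Isom Y → Y.Isom Z → X.Isom Z := by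
  rintro ⟨e, he⟩ ⟨f, hf⟩
  exact ⟨e.trans f, fun g x => by simp [he, hf]⟩

instance isomSetoid (G : Type u) [Group G] : Setoid (FinGSet G) where
  r := FinGSet.Isom
  iseqv := ⟨FinGSet.Isom.refl, FinGSet.Isom.symm, FinGSet.Isom.trans⟩

end GSets

/-! ### The Burnside ring -/

/-- Isomorphism classes of finite `G`-sets. -/
def GSetClass (G : Type u) [Group G] : Type (u + 1) := Quotient (isomSetoid G)

section Burnside

variable {G : Type u} [Group G]

/-- The isomorphism class of a finite `G`-set. -/
def GSetClass.mk (X : FinGSet G) : GSetClass G := Quotient.mk _ X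

/-- The isomorphism classes of finite `G`-sets form a commutative monoid under the cartesian
product (with diagonal action). -/
instance : CommMonoid (GSetClass G) where
  one := GSetClass.mk (FinGSet.of PUnit.{u + 1})
  mul := Quotient.map₂ (fun X Y => FinGSet.of (X × Y)) (by
    rintro X X' ⟨e, he⟩ Y Y' ⟨f, hf⟩
    exact ⟨Equiv.prodCongr e f, fun g x => Prod.ext (he g x.1) (hf g x.2)⟩)
  mul_assoc := by
    rintro ⟨X⟩ ⟨Y⟩ ⟨Z⟩
    exact Quotient.sound ⟨Equiv.prodAssoc X Y Z, fun _ _ => rfl⟩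
  one_mul := by
    rintro ⟨X⟩
    exact Quotient.sound ⟨Equiv.punitProd X, fun _ _ => rfl⟩
  mul_one := by
    rintro ⟨X⟩
    exact Quotient.sound ⟨Equiv.prodPUnit X, fun _ _ => rfl⟩
  mul_comm := by
    rintro ⟨X⟩ ⟨Y⟩
    exact Quotient.sound ⟨Equiv.prodComm X Y, fun _ _ => rfl⟩

/-- The relations `[X ⊔ Y] = [X] + [Y]`. -/
def burnsideRelations (G : Type u) [Group G] : Ideal (MonoidAlgebra ℤ (GSetClass G)) :=
  Ideal.span {r | ∃ X Y : FinGSet G, r =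
    MonoidAlgebra.of ℤ _ (GSetClass.mk (FinGSet.of (X ⊕ Y)))
      - MonoidAlgebra.of ℤ _ (GSetClass.mk X) - MonoidAlgebra.of ℤ _ (GSetClass.mk Y)}

/-- The integral Burnside ring: the Grothendieck ring of finite `G`-sets, with addition
induced by disjoint union and multiplication by the cartesian product. -/
def IntBurnsideRing (G : Type u) [Group G] : Type (u + 1) :=
  MonoidAlgebra ℤ (GSetClass G) ⧸ burnsideRelations G

instance : CommRing (IntBurnsideRing G) :=
  inferInstanceAs (CommRing (MonoidAlgebra ℤ (GSetClass G) ⧸ burnsideRelations G))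

/-- The quotient map onto the integral Burnside ring. -/
def toIntBurnsideRing (G : Type u) [Group G] :
    MonoidAlgebra ℤ (GSetClass G) →+* IntBurnsideRing G :=
  Ideal.Quotient.mk (burnsideRelations G)

open scoped TensorProduct in
/-- The rational Burnside ring `ℚ ⊗ Ω_ℤ(G)`. -/
def BurnsideRing (G : Type u) [Group G] : Type (u + 1) := ℚ ⊗[ℤ] IntBurnsideRing G

open scoped TensorProduct in
instance : CommRing (BurnsideRing G) :=
  inferInstanceAs (CommRing (ℚ ⊗[ℤ] IntBurnsideRing G))

open scoped TensorProduct in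
instance : Algebra ℚ (BurnsideRing G) :=
  inferInstanceAs (Algebra ℚ (ℚ ⊗[ℤ] IntBurnsideRing G))

open scoped TensorProduct in
/-- Extension of scalars `Ω_ℤ(G) → Ω(G)`. -/
def toBurnsideRing (G : Type u) [Group G] : IntBurnsideRing G →+* BurnsideRing G :=
  (Algebra.TensorProduct.includeRight : IntBurnsideRing G →ₐ[ℤ] ℚ ⊗[ℤ] IntBurnsideRing G).toRingHom

/-- The class of a finite `G`-set in the integral Burnside ring. -/
def intClass (X : FinGSet G) : IntBurnsideRing G :=
  toIntBurnsideRing G (MonoidAlgebra.of ℤ _ (GSetClass.mk X))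

/-- The class `[X]` of a finite `G`-set in the rational Burnside ring. -/
def burnsideClass (X : FinGSet G) : BurnsideRing G := toBurnsideRing G (intClass X)

theorem intClass_sum (X Y : FinGSet G) :
    intClass (FinGSet.of (X ⊕ Y)) = intClass X + intClass Y := by
  rw [← sub_eq_zero, ← sub_sub]
  unfold intClass
  rw [← map_sub, ← map_sub]
  exact Ideal.Quotient.eq_zero_iff_mem.2 (Ideal.subset_span ⟨X, Y, rfl⟩)

theorem intClass_congr {X Y : FinGSet G} (h : X.Isom Y) : intClass X = intClass Y := by
  have : GSetClass.mk X = GSetClass.mk Y := Quotient.sound h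
  rw [intClass, this, intClass]

theorem burnsideClass_sum (X Y : FinGSet G) :
    burnsideClass (FinGSet.of (X ⊕ Y)) = burnsideClass X + burnsideClass Y := by
  simp only [burnsideClass, intClass_sum, map_add]

theorem burnsideClass_congr {X Y : FinGSet G} (h : X.Isom Y) :
    burnsideClass X = burnsideClass Y := by
  simp only [burnsideClass, intClass_congr h]

/-! ### Marks -/

/-- The number of `H`-fixed points of a finite `G`-set. -/
def fixedCard (H : Subgroup G) (X : FinGSet G) : ℕ :=
  Nat.card {x : X // ∀ h ∈ H, h • x = x}

theorem fixedCard_congr (H : Subgroup G) {X Y : FinGSet G} (h : X.Isom Y) :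
    fixedCard H X = fixedCard H Y := by
  obtain ⟨e, he⟩ := h
  exact Nat.card_congr (e.subtypeEquiv fun x => by
    simp only [← he, EmbeddingLike.apply_eq_iff_eq])

theorem fixedCard_prod (H : Subgroup G) (X Y : FinGSet G) :
    fixedCard H (FinGSet.of (X × Y)) = fixedCard H X * fixedCard H Y := by
  unfold fixedCard
  rw [← Nat.card_prod]
  refine Nat.card_congr ⟨fun x => ⟨⟨x.1.1, fun h hh => congrArg Prod.fst (x.2 h hh)⟩,
    ⟨x.1.2, fun h hh => congrArg Prod.snd (x.2 h hh)⟩⟩,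
    fun x => ⟨(x.1.1, x.2.1), fun h hh => Prod.ext (x.1.2 h hh) (x.2.2 h hh)⟩,
    fun _ => rfl, fun _ => rfl⟩

theorem fixedCard_sum (H : Subgroup G) (X Y : FinGSet G) :
    fixedCard H (FinGSet.of (X ⊕ Y)) = fixedCard H X + fixedCard H Y := by
  unfold fixedCard
  rw [← Nat.card_sum]
  refine Nat.card_congr (Equiv.trans (Equiv.subtypeSum) (Equiv.sumCongr ?_ ?_))
  · exact Equiv.subtypeEquivRight fun x =>
      forall₂_congr fun h _ => Sum.inl_injective.eq_iff
  · exact Equiv.subtypeEquivRight fun x =>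
      forall₂_congr fun h _ => Sum.inr_injective.eq_iff

/-- `[X] ↦ |X^H|` on isomorphism classes. -/
def fixedCardHom (H : Subgroup G) : GSetClass G →* ℤ where
  toFun := Quotient.lift (fun X => (fixedCard H X : ℤ))
    fun X Y h => by rw [fixedCard_congr H h]
  map_one' := by
    change ((fixedCard H (FinGSet.of PUnit.{u + 1}) : ℕ) : ℤ) = 1
    have : fixedCard H (FinGSet.of PUnit.{u + 1}) = 1 := by
      unfold fixedCard
      rw [Nat.card_eq_one_iff_unique]
      exact ⟨⟨fun _ _ => Subtype.ext (Subsingleton.elim (α := PUnit) _ _)⟩,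
        ⟨⟨PUnit.unit, fun _ _ => rfl⟩⟩⟩
    rw [this]; rfl
  map_mul' := by
    rintro ⟨X⟩ ⟨Y⟩
    change ((fixedCard H (FinGSet.of (X × Y)) : ℕ) : ℤ) = fixedCard H X * fixedCard H Y
    rw [fixedCard_prod]; push_cast; rfl

theorem burnsideRelations_le_ker (H : Subgroup G) (a : MonoidAlgebra ℤ (GSetClass G))
    (ha : a ∈ burnsideRelations G) :
    (MonoidAlgebra.lift ℤ ℤ (GSetClass G) (fixedCardHom H)).toRingHom a = 0 := by
  suffices burnsideRelations G ≤ RingHom.ker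
      (MonoidAlgebra.lift ℤ ℤ (GSetClass G) (fixedCardHom H)).toRingHom from this ha
  refine Ideal.span_le.2 ?_
  rintro _ ⟨X, Y, rfl⟩
  have key : ∀ Z : FinGSet G, fixedCardHom H (GSetClass.mk Z) = (fixedCard H Z : ℤ) :=
    fun _ => rfl
  simp [RingHom.mem_ker, key, fixedCard_sum]

/-- The ring homomorphism `Ω_ℤ(G) → ℤ`, `[X] ↦ |X^H|`. -/
def intMark (H : Subgroup G) : IntBurnsideRing G →+* ℤ :=
  Ideal.Quotient.lift (burnsideRelations G)
    (MonoidAlgebra.lift ℤ ℤ (GSetClass G) (fixedCardHom H)).toRingHom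
    (burnsideRelations_le_ker H)

theorem intMark_intClass (H : Subgroup G) (X : FinGSet G) :
    intMark H (intClass X) = fixedCard H X :=
  MonoidAlgebra.lift_of (fixedCardHom H) (GSetClass.mk X)

open scoped TensorProduct in
/-- The mark homomorphism `m_H : Ω(G) → ℚ`, `[X] ↦ |X^H|`. -/
def mark (H : Subgroup G) : BurnsideRing G →ₐ[ℚ] ℚ :=
  (Algebra.TensorProduct.lift (AlgHom.id ℚ ℚ)
    ((Int.castRingHom ℚ).comp (intMark H)).toIntAlgHom (fun _ _ => Commute.all _ _) :
    ℚ ⊗[ℤ] IntBurnsideRing G →ₐ[ℚ] ℚ)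

theorem mark_toBurnsideRing (H : Subgroup G) (x : IntBurnsideRing G) :
    mark H (toBurnsideRing G x) = intMark H x := by
  refine (Algebra.TensorProduct.lift_tmul (AlgHom.id ℚ ℚ)
    ((Int.castRingHom ℚ).comp (intMark H)).toIntAlgHom (fun _ _ => Commute.all _ _) 1 x).trans ?_
  rw [map_one, one_mul]
  rfl

theorem mark_burnsideClass (H : Subgroup G) (X : FinGSet G) :
    mark H (burnsideClass X) = fixedCard H X := by
  rw [burnsideClass, mark_toBurnsideRing, intMark_intClass, Int.cast_natCast]

/-- The transitive `G`-set `G ⧸ H`. -/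
abbrev orbit [Finite G] (H : Subgroup G) : FinGSet G := FinGSet.of (G ⧸ H)

/-- `H` and `K` are conjugate in `G`. -/
def ConjSubgroups (H K : Subgroup G) : Prop := ∃ g : G, K = MulAut.conj g • H

theorem mem_conj_smul {g x : G} {H : Subgroup G} :
    x ∈ MulAut.conj g • H ↔ g⁻¹ * x * g ∈ H := by
  rw [Subgroup.mem_pointwise_smul_iff_inv_smul_mem, ← map_inv, MulAut.smul_def, MulAut.conj_apply,
    inv_inv]

theorem ConjSubgroups.symm {H K : Subgroup G} : ConjSubgroups H K → ConjSubgroups K H := by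
  rintro ⟨g, rfl⟩
  exact ⟨g⁻¹, by rw [map_inv, inv_smul_smul]⟩

theorem fixedCard_conj {H K : Subgroup G} (h : ConjSubgroups H K) (X : FinGSet G) :
    fixedCard H X = fixedCard K X := by
  obtain ⟨g, rfl⟩ := h
  refine Nat.card_congr ((MulAction.toPerm g).subtypeEquiv fun x => ?_)
  simp only [mem_conj_smul, MulAction.toPerm_apply]
  constructor
  · intro hx k hk
    have := hx _ hk
    rw [mul_smul, mul_smul, inv_smul_eq_iff] at this
    exact this
  · intro hx k hk
    have := hx (g * k * g⁻¹) (by simpa [mul_assoc] using hk)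
    rw [mul_smul, mul_smul, inv_smul_smul] at this
    exact smul_left_cancel g this

theorem orbit_isom_of_conj [Finite G] {H K : Subgroup G} (h : ConjSubgroups H K) :
    (orbit K).Isom (orbit H) := by
  obtain ⟨g, rfl⟩ := h
  have key : ∀ a b : G, (QuotientGroup.leftRel (MulAut.conj g • H)) a b ↔
      (QuotientGroup.leftRel H) (Equiv.mulRight g a) (Equiv.mulRight g b) := by
    intro a b
    rw [QuotientGroup.leftRel_apply, QuotientGroup.leftRel_apply, mem_conj_smul]
    simp [mul_assoc]
  refine ⟨Quotient.congr (Equiv.mulRight g) key, ?_⟩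
  rintro k ⟨a⟩
  exact congrArg (QuotientGroup.mk (s := H)) (mul_assoc k a g)

theorem fixedCard_orbit_self [Finite G] (H : Subgroup G) : fixedCard H (orbit H) ≠ 0 := by
  refine Nat.card_ne_zero.2 ⟨⟨⟨((1 : G) : G ⧸ H), fun h hh => ?_⟩⟩, inferInstance⟩
  change ((h * 1 : G) : G ⧸ H) = _
  rw [eq_comm, QuotientGroup.eq]
  simpa using hh

theorem conj_of_fixedCard_ne_zero [Finite G] {H K : Subgroup G} (hc : Nat.card K ≤ Nat.card H)
    (h : fixedCard H (orbit K) ≠ 0) : ConjSubgroups K H := by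
  obtain ⟨⟨⟨a, ha⟩⟩, -⟩ := Nat.card_ne_zero.1 h
  induction a using QuotientGroup.induction_on with
  | _ a =>
    have hle : H ≤ MulAut.conj a • K := by
      intro x hx
      have := ha x hx
      change ((x * a : G) : G ⧸ K) = _ at this
      rw [eq_comm, QuotientGroup.eq, ← mul_assoc] at this
      exact mem_conj_smul.2 this
    refine ⟨a, Subgroup.eq_of_le_of_card_ge hle (le_of_eq_of_le ?_ hc)⟩
    exact Nat.card_congr (Subgroup.equivSMul (MulAut.conj a) K).symm.toEquiv

/-- Every finite `G`-set is a sum of transitive ones in the Burnside ring. -/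
theorem burnsideClass_mem_span [Finite G] (n : ℕ) : ∀ X : FinGSet G, Nat.card X = n →
    burnsideClass X ∈ Submodule.span ℚ (Set.range fun H : Subgroup G =>
      burnsideClass (orbit H)) := by
  induction n using Nat.strong_induction_on with
  | _ n ih =>
    intro X hX
    rcases isEmpty_or_nonempty X with hE | ⟨⟨x⟩⟩
    · have h0 : burnsideClass X = burnsideClass X + burnsideClass X := by
        rw [← burnsideClass_sum]
        exact burnsideClass_congr ⟨(Equiv.sumEmpty X X).symm, fun g x => rfl⟩
      rw [left_eq_add.1 h0]
      exact Submodule.zero_mem _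
    · let C : SubMulAction G X :=
        { carrier := (MulAction.orbit G x)ᶜ
          smul_mem' := fun g y hy hgy => hy (by
            rwa [MulAction.mem_orbit_symm, MulAction.orbit_smul, MulAction.mem_orbit_symm] at hgy) }
      have hiso : (FinGSet.of (orbit (MulAction.stabilizer G x) ⊕ C)).Isom X := by
        classical
        refine ⟨(Equiv.sumCongr (MulAction.orbitEquivQuotientStabilizer G x).symm
          (Equiv.refl _)).trans (Equiv.Set.sumCompl (MulAction.orbit G x)), ?_⟩
        rintro g (⟨⟨a⟩⟩ | y)
        · exact mul_smul g a x
        · rfl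
      rw [← burnsideClass_congr hiso]
      rw [burnsideClass_sum (orbit (MulAction.stabilizer G x)) (FinGSet.of C)]
      refine Submodule.add_mem _ (Submodule.subset_span ⟨_, rfl⟩) (ih _ ?_ (FinGSet.of C) rfl)
      rw [← hX]
      exact Finite.card_subtype_lt (p := fun y => y ∈ C) (x := x)
        (fun h => h (MulAction.mem_orbit_self x))

open scoped TensorProduct in
/-- The transitive `G`-sets span the rational Burnside ring. -/
theorem span_orbits [Finite G] : Submodule.span ℚ (Set.range fun H : Subgroup G =>
    burnsideClass (orbit H)) = ⊤ := by
  rw [Submodule.eq_top_iff']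
  have hint : ∀ r : IntBurnsideRing G, toBurnsideRing G r ∈ Submodule.span ℚ
      (Set.range fun H : Subgroup G => burnsideClass (orbit H)) := by
    intro r
    obtain ⟨r, rfl⟩ := Ideal.Quotient.mk_surjective r
    change toBurnsideRing G (toIntBurnsideRing G r) ∈ _
    induction r using MonoidAlgebra.induction_on with
    | of X =>
      obtain ⟨X⟩ := X
      exact burnsideClass_mem_span _ X rfl
    | add f g hf hg =>
      rw [map_add, map_add]
      exact Submodule.add_mem _ hf hg
    | smul z f hf =>
      rw [map_zsmul, map_zsmul, ← Int.cast_smul_eq_zsmul ℚ]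
      exact Submodule.smul_mem _ _ hf
  intro x
  induction x using TensorProduct.induction_on with
  | zero => exact Submodule.zero_mem _
  | add x y hx hy => exact Submodule.add_mem _ hx hy
  | tmul q r =>
    have : q ⊗ₜ[ℤ] r = q • (1 ⊗ₜ[ℤ] r : TensorProduct ℤ ℚ (IntBurnsideRing G)) := by
      rw [TensorProduct.smul_tmul', smul_eq_mul, mul_one]
    rw [this]
    exact Submodule.smul_mem _ q (hint r)

/-- An element of the rational Burnside ring is determined by its marks. -/
theorem eq_zero_of_marks [Finite G] (x : BurnsideRing G) (hx : ∀ H, mark H x = 0) : x = 0 := by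
  classical
  have main : ∀ (n : ℕ) (T : Finset (Subgroup G)) (a : Subgroup G → ℚ), T.card = n →
      (∀ H, mark H (∑ K ∈ T, a K • burnsideClass (orbit K)) = 0) →
      ∑ K ∈ T, a K • burnsideClass (orbit K) = 0 := by
    intro n
    induction n using Nat.strong_induction_on with
    | _ n ih =>
      intro T a hT hm
      rcases T.eq_empty_or_nonempty with rfl | hne
      · simp
      obtain ⟨H, hHT, hmax⟩ := T.exists_max_image (fun K => Nat.card K) hne
      have hcl : ∑ K ∈ T with ConjSubgroups K H, a K • burnsideClass (orbit K) =
          (∑ K ∈ T with ConjSubgroups K H, a K) • burnsideClass (orbit H) := by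
        rw [Finset.sum_smul]
        refine Finset.sum_congr rfl fun K hK => ?_
        rw [burnsideClass_congr (orbit_isom_of_conj (Finset.mem_filter.1 hK).2.symm)]
      have hsplit := Finset.sum_filter_add_sum_filter_not T (fun K => ConjSubgroups K H)
        (fun K => a K • burnsideClass (orbit K))
      have hzero : mark H (∑ K ∈ T with ¬ ConjSubgroups K H,
          a K • burnsideClass (orbit K)) = 0 := by
        rw [map_sum]
        refine Finset.sum_eq_zero fun K hK => ?_
        obtain ⟨hKT, hK⟩ := Finset.mem_filter.1 hK
        rw [map_smul, mark_burnsideClass]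
        have : fixedCard H (orbit K) = 0 := by
          by_contra h
          exact hK (conj_of_fixedCard_ne_zero (hmax K hKT) h)
        rw [this]; simp
      have hH := hm H
      rw [← hsplit, map_add, hzero, add_zero, hcl, map_smul, mark_burnsideClass, smul_eq_mul,
        mul_eq_zero, or_iff_left (Nat.cast_ne_zero.2 (fixedCard_orbit_self H))] at hH
      have hT' : ∑ K ∈ T, a K • burnsideClass (orbit K) =
          ∑ K ∈ T with ¬ ConjSubgroups K H, a K • burnsideClass (orbit K) := by
        rw [← hsplit, hcl, hH, zero_smul, zero_add]
      rw [hT'] at hm ⊢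
      refine ih _ ?_ _ a rfl hm
      rw [← hT]
      exact Finset.card_lt_card (Finset.filter_ssubset.2
        ⟨H, hHT, fun h => h ⟨1, by simp⟩⟩)
  have hspan : x ∈ Submodule.span ℚ (Set.range fun H : Subgroup G =>
      burnsideClass (orbit H)) := by rw [span_orbits]; trivial
  have := Fintype.ofFinite (Subgroup G)
  obtain ⟨a, rfl⟩ := (Submodule.mem_span_range_iff_exists_fun ℚ).1 hspan
  exact main _ Finset.univ a rfl hx

theorem mark_conj [Finite G] {H K : Subgroup G} (h : ConjSubgroups H K) (x : BurnsideRing G) :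
    mark H x = mark K x := by
  have : (mark H).toLinearMap = (mark K).toLinearMap := by
    refine LinearMap.ext_on span_orbits ?_
    rintro _ ⟨L, rfl⟩
    simp only [AlgHom.toLinearMap_apply, mark_burnsideClass, fixedCard_conj h]
  exact LinearMap.congr_fun this x

/-! ### Primitive idempotents -/

/-- A primitive idempotent of a commutative ring: a non-zero idempotent `e` such that the only
idempotents `f` with `f * e = f` are `0` and `e`. -/
def IsPrimitiveIdempotent {R : Type v} [CommRing R] (e : R) : Prop :=
  IsIdempotentElem e ∧ e ≠ 0 ∧ ∀ f : R, IsIdempotentElem f → f * e = f → f = 0 ∨ f = e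

theorem exists_separating [Finite G] {H K : Subgroup G} (h : ¬ ConjSubgroups H K) :
    ∃ x : BurnsideRing G, mark H x = 1 ∧ mark K x = 0 := by
  have key : ∃ y : BurnsideRing G, mark H y ≠ mark K y := by
    rcases le_total (Nat.card H) (Nat.card K) with hc | hc
    · refine ⟨burnsideClass (orbit H), ?_⟩
      have h0 : fixedCard K (orbit H) = 0 := by
        by_contra h'
        exact h (conj_of_fixedCard_ne_zero hc h')
      rw [mark_burnsideClass, mark_burnsideClass, h0]
      exact_mod_cast fixedCard_orbit_self H
    · refine ⟨burnsideClass (orbit K), ?_⟩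
      have h0 : fixedCard H (orbit K) = 0 := by
        by_contra h'
        exact h (conj_of_fixedCard_ne_zero hc h').symm
      rw [mark_burnsideClass, mark_burnsideClass, h0]
      exact_mod_cast (fixedCard_orbit_self K).symm
  obtain ⟨y, hy⟩ := key
  refine ⟨(mark H y - mark K y)⁻¹ • (y - algebraMap ℚ _ (mark K y)), ?_, ?_⟩
  · rw [map_smul, map_sub, AlgHom.commutes]
    exact inv_mul_cancel₀ (sub_ne_zero.2 hy)
  · rw [map_smul, map_sub, AlgHom.commutes]
    simp

open Classical in
theorem exists_idempotent_marks [Finite G] (H : Subgroup G) :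
    ∃ e : BurnsideRing G, ∀ K, mark K e = if ConjSubgroups H K then 1 else 0 := by
  have := Fintype.ofFinite (Subgroup G)
  choose x hx using fun K : {K : Subgroup G // ¬ ConjSubgroups H K} => exists_separating K.2
  refine ⟨∏ K, x K, fun K => ?_⟩
  split_ifs with h
  · rw [← mark_conj h, map_prod]
    exact Finset.prod_eq_one fun L _ => (hx L).1
  · rw [map_prod]
    exact Finset.prod_eq_zero (Finset.mem_univ ⟨K, h⟩) (hx ⟨K, h⟩).2

theorem existsUnique_primitiveIdempotent [Finite G] (H : Subgroup G) :
    ∃! e : BurnsideRing G, IsPrimitiveIdempotent e ∧ mark H e = 1 := by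
  classical
  obtain ⟨e, he⟩ := exists_idempotent_marks H
  have hH : mark H e = 1 := by rw [he, if_pos ⟨1, by simp⟩]
  have hne : e ≠ 0 := by rintro rfl; simp at hH
  have hid : IsIdempotentElem e := sub_eq_zero.1 (eq_zero_of_marks _ fun K => by
    rw [map_sub, map_mul, he]; split_ifs <;> simp)
  have hprim : ∀ f : BurnsideRing G, IsIdempotentElem f → f * e = f → f = 0 ∨ f = e := by
    intro f hf hfe
    have hm : mark H f * mark H f = mark H f := by rw [← map_mul, hf]
    have hout : ∀ K, ¬ ConjSubgroups H K → mark K f = 0 := fun K hK => by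
      rw [← hfe, map_mul, he, if_neg hK, mul_zero]
    have hm' : mark H f = 0 ∨ mark H f = 1 := by
      rcases eq_or_ne (mark H f) 0 with h | h
      · exact Or.inl h
      · exact Or.inr (mul_left_cancel₀ h (by rw [hm, mul_one]))
    rcases hm' with h0 | h1
    · left
      refine eq_zero_of_marks _ fun K => ?_
      by_cases hK : ConjSubgroups H K
      · rw [← mark_conj hK, h0]
      · exact hout K hK
    · right
      refine sub_eq_zero.1 (eq_zero_of_marks _ fun K => ?_)
      rw [map_sub, he]
      split_ifs with hK
      · rw [← mark_conj hK, h1, sub_self]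
      · rw [hout K hK, sub_self]
  refine ⟨e, ⟨⟨hid, hne, hprim⟩, hH⟩, ?_⟩
  rintro f ⟨⟨fid, fne, fprim⟩, hfH⟩
  have hmul : IsIdempotentElem (f * e) := fid.mul hid
  have h1 : mark H (f * e) = 1 := by rw [map_mul, hfH, hH, one_mul]
  have h0 : f * e ≠ 0 := fun h => by rw [h, map_zero] at h1; exact zero_ne_one h1
  have ha := (hprim (f * e) hmul (by rw [mul_assoc, hid])).resolve_left h0
  have hb := (fprim (f * e) hmul (by rw [mul_right_comm, fid])).resolve_left h0
  rw [← hb, ha]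

/-- The primitive idempotent `ε_H` of `Ω(G)` corresponding to the subgroup `H`: the unique
primitive idempotent with `m_H(ε_H) = 1`. -/
def primIdempotent [Finite G] (H : Subgroup G) : BurnsideRing G :=
  (existsUnique_primitiveIdempotent H).choose

end Burnside

/-! ### Euler characteristic of a finite category -/

section EulerCharacteristic

/-- A weighting on a finite category: `∑_y |C(x,y)| k(y) = 1` for all `x`. -/
def IsWeighting (C : Type u) [Category.{v} C] (k : C → ℚ) : Prop :=
  ∀ x : C, ∑ᶠ y : C, (Nat.card (x ⟶ y) : ℚ) * k y = 1

/-- A coweighting on a finite category: `∑_x k(x) |C(x,y)| = 1` for all `y`. -/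
def IsCoweighting (C : Type u) [Category.{v} C] (k : C → ℚ) : Prop :=
  ∀ y : C, ∑ᶠ x : C, k x * (Nat.card (x ⟶ y) : ℚ) = 1

/-- `C` has an Euler characteristic if it has a weighting and a coweighting. -/
def HasEulerChar (C : Type u) [Category.{v} C] : Prop :=
  (∃ k, IsWeighting C k) ∧ ∃ k, IsCoweighting C k

open Classical in
/-- The Euler characteristic: the total weight of any weighting (or coweighting). -/
def eulerChar (C : Type u) [Category.{v} C] : ℚ :=
  if h : HasEulerChar C then ∑ᶠ x : C, h.1.choose x else 0

/-- The reduced Euler characteristic. -/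
def reducedEulerChar (C : Type u) [Category.{v} C] : ℚ := eulerChar C - 1

theorem sum_weighting_eq_sum_coweighting {C : Type u} [Category.{v} C] [Finite C] {k l : C → ℚ}
    (hk : IsWeighting C k) (hl : IsCoweighting C l) : ∑ᶠ x, k x = ∑ᶠ x, l x := by
  have := Fintype.ofFinite C
  simp only [IsWeighting, IsCoweighting, finsum_eq_sum_of_fintype] at *
  calc ∑ y, k y = ∑ y, (∑ x, l x * (Nat.card (x ⟶ y) : ℚ)) * k y := by simp [hl]
    _ = ∑ x, l x * ∑ y, (Nat.card (x ⟶ y) : ℚ) * k y := by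
      simp only [Finset.sum_mul, Finset.mul_sum]
      rw [Finset.sum_comm]
      simp only [mul_assoc]
    _ = ∑ x, l x := by simp [hk]

theorem eulerChar_eq_weighting {C : Type u} [Category.{v} C] [Finite C] {k l : C → ℚ}
    (hk : IsWeighting C k) (hl : IsCoweighting C l) : eulerChar C = ∑ᶠ x, k x := by
  have h : HasEulerChar C := ⟨⟨k, hk⟩, ⟨l, hl⟩⟩
  rw [eulerChar, dif_pos h, sum_weighting_eq_sum_coweighting h.1.choose_spec hl,
    sum_weighting_eq_sum_coweighting hk hl]

theorem natCard_poset_hom {P : Type u} [PartialOrder P] (x y : P) [Decidable (x ≤ y)] :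
    (Nat.card (x ⟶ y) : ℚ) = if x ≤ y then 1 else 0 := by
  split_ifs with h
  · have : Nat.card (x ⟶ y) = 1 :=
      Nat.card_eq_one_iff_unique.2 ⟨inferInstance, ⟨homOfLE h⟩⟩
    rw [this, Nat.cast_one]
  · have : IsEmpty (x ⟶ y) := ⟨fun f => h (leOfHom f)⟩
    rw [Nat.card_of_isEmpty, Nat.cast_zero]

theorem exists_poset_weight (P : Type u) [PartialOrder P] [Fintype P] [DecidableLE P] :
    ∃ k : P → ℚ, ∀ x, ∑ y, (if x ≤ y then 1 else 0) * k y = 1 := by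
  classical
  have wf : WellFounded ((· > ·) : P → P → Prop) := wellFounded_gt
  let k : P → ℚ := wf.fix fun x ih => 1 - ∑ y, if h : y > x then ih y h else 0
  have hk : ∀ x, k x = 1 - ∑ y, if y > x then k y else 0 := fun x => by
    have := wf.fix_eq (fun x (ih : ∀ y, y > x → ℚ) =>
      (1 : ℚ) - ∑ y, if h : y > x then ih y h else 0) x
    simpa using this
  refine ⟨k, fun x => ?_⟩
  have : ∀ y, (if x ≤ y then (1 : ℚ) else 0) * k y =
      (if y = x then k y else 0) + if y > x then k y else 0 := by
    intro y
    rcases eq_or_ne y x with rfl | hne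
    · simp
    · simp [hne, lt_iff_le_and_ne, hne.symm]
  simp only [this, Finset.sum_add_distrib, Finset.sum_ite_eq', Finset.mem_univ, if_true]
  rw [hk x]; ring

/-- Every finite poset has an Euler characteristic. -/
theorem hasEulerChar_poset (P : Type u) [PartialOrder P] [Finite P] : HasEulerChar P := by
  classical
  have := Fintype.ofFinite P
  constructor
  · obtain ⟨k, hk⟩ := exists_poset_weight P
    refine ⟨k, fun x => ?_⟩
    rw [finsum_eq_sum_of_fintype]
    simpa only [natCard_poset_hom] using hk x
  · obtain ⟨k, hk⟩ := exists_poset_weight Pᵒᵈ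
    refine ⟨fun x => k (OrderDual.toDual x), fun y => ?_⟩
    rw [finsum_eq_sum_of_fintype]
    simp only [natCard_poset_hom, mul_comm]
    exact hk (OrderDual.toDual y)

end EulerCharacteristic

/-! ### The series Lefschetz invariant of a finite `G`-category

A `G`-category is an object of `Action Cat G`: a category `D.V` on which `G` acts by functors
`D.ρ g`, strictly. -/

section Lefschetz

variable {G : Type u} [Group G]

/-- The morphism `f` is an identity morphism. -/
def IsIdentity {C : Type u} [Category.{v} C] {x y : C} (f : x ⟶ y) : Prop :=
  ∃ h : x = y, f = eqToHom h

theorem IsIdentity.map {C D : Type u} [Category.{v} C] [Category.{v} D] (F : C ⥤ D) {x y : C}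
    {f : x ⟶ y} (h : IsIdentity f) : IsIdentity (F.map f) := by
  obtain ⟨rfl, rfl⟩ := h
  exact ⟨rfl, by simp⟩

/-- The non-degenerate `n`-simplices of the nerve of `C`: chains
`x_0 ⟶ x_1 ⟶ ⋯ ⟶ x_n` none of whose arrows `x_i ⟶ x_{i+1}` is an identity. -/
def NondegSimplex (C : Type u) [Category.{v} C] (n : ℕ) : Type (max u v) :=
  {σ : ComposableArrows C n // ∀ (i : ℕ) (hi : i < n), ¬ IsIdentity (σ.map' i (i + 1))}

theorem composableArrows_finite (C : Type u) [Category.{v} C] [Finite C]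
    [∀ x y : C, Finite (x ⟶ y)] (n : ℕ) : Finite (ComposableArrows C n) := by
  refine Finite.of_injective
    (β := Σ o : Fin (n + 1) → C, ∀ i j : Fin (n + 1), i ≤ j → (o i ⟶ o j))
    (fun σ => ⟨σ.obj, fun i j h => σ.map (homOfLE h)⟩) ?_
  rintro ⟨o, m, h1, h2⟩ ⟨o', m', h1', h2'⟩ h
  obtain ⟨rfl, h⟩ := Sigma.mk.inj_iff.1 h
  congr
  ext i j f
  exact congrFun (congrFun (congrFun (eq_of_heq h) i) j) (leOfHom f)

instance (C : Type u) [Category.{v} C] [Finite C] [∀ x y : C, Finite (x ⟶ y)] (n : ℕ) :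
    Finite (NondegSimplex C n) :=
  have := composableArrows_finite C n
  Subtype.finite

theorem rho_toFunctor_one (D : Action Cat.{v, u} G) :
    (D.ρ 1).toFunctor = 𝟭 D.V := by
  rw [map_one]; rfl

theorem rho_toFunctor_mul (D : Action Cat.{v, u} G) (g h : G) :
    (D.ρ (g * h)).toFunctor = (D.ρ h).toFunctor ⋙ (D.ρ g).toFunctor := by
  rw [map_mul]; rfl

theorem isIdentity_of_map_rho (D : Action Cat.{v, u} G) (g : G) {x y : D.V} {f : x ⟶ y}
    (h : IsIdentity ((D.ρ g).toFunctor.map f)) : IsIdentity f := by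
  have h1 := h.map (D.ρ g⁻¹).toFunctor
  have h2 : (D.ρ g).toFunctor ⋙ (D.ρ g⁻¹).toFunctor = 𝟭 D.V := by
    rw [← rho_toFunctor_mul, inv_mul_cancel, rho_toFunctor_one]
  have h3 : IsIdentity (((D.ρ g).toFunctor ⋙ (D.ρ g⁻¹).toFunctor).map f) := h1
  rw [h2] at h3
  exact h3

/-- `G` acts on the non-degenerate `n`-simplices of a `G`-category. -/
instance (D : Action Cat.{v, u} G) (n : ℕ) : MulAction G (NondegSimplex D.V n) where
  smul g σ := ⟨σ.1 ⋙ (D.ρ g).toFunctor, fun i hi h => σ.2 i hi (isIdentity_of_map_rho D g h)⟩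
  one_smul σ := Subtype.ext (by
    change σ.1 ⋙ (D.ρ 1).toFunctor = σ.1
    rw [rho_toFunctor_one]; rfl)
  mul_smul g h σ := Subtype.ext (by
    change σ.1 ⋙ (D.ρ (g * h)).toFunctor = _
    rw [rho_toFunctor_mul]; rfl)

/-- The power series `f_D(t) = ∑_n [D_n] t^n ∈ Ω(G)[[t]]`, where `D_n` is the `G`-set of
non-degenerate `n`-simplices of `D`. -/
def simplexSeries (D : Action Cat.{u, u} G) [Finite D.V] [∀ x y : D.V, Finite (x ⟶ y)] :
    PowerSeries (BurnsideRing G) :=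
  PowerSeries.mk fun n => burnsideClass (FinGSet.of (NondegSimplex D.V n))

/-- `f ∈ Ω(G)[[t]]` lies in `Ω(G) ⊗ ℚ[t]_{(t+1)}` and its value at `t = -1` is `L`: there are
polynomials `q ∈ ℚ[t]` and `p ∈ Ω(G)[t]` with `q(-1) ≠ 0`, `q f = p` and `L = p(-1) / q(-1)`. -/
def HasValueAtNegOne (f : PowerSeries (BurnsideRing G)) (L : BurnsideRing G) : Prop :=
  ∃ (q : Polynomial ℚ) (p : Polynomial (BurnsideRing G)), q.eval (-1) ≠ 0 ∧
    ((q.map (algebraMap ℚ (BurnsideRing G)) : Polynomial (BurnsideRing G)) :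
      PowerSeries (BurnsideRing G)) * f = p ∧
    L = (q.eval (-1))⁻¹ • p.eval (-1)

/-- The value at `-1` is well-defined. -/
theorem HasValueAtNegOne.unique {f : PowerSeries (BurnsideRing G)} {L L' : BurnsideRing G}
    (h : HasValueAtNegOne f L) (h' : HasValueAtNegOne f L') : L = L' := by
  obtain ⟨q, p, hq, hf, rfl⟩ := h
  obtain ⟨q', p', hq', hf', rfl⟩ := h'
  have hpoly : q.map (algebraMap ℚ (BurnsideRing G)) * p' =
      q'.map (algebraMap ℚ (BurnsideRing G)) * p := by
    apply Polynomial.coe_injective (BurnsideRing G)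
    rw [Polynomial.coe_mul, Polynomial.coe_mul, ← hf, ← hf']
    ring
  have hev := congrArg (Polynomial.eval (-1)) hpoly
  have hm : ∀ r : Polynomial ℚ, (r.map (algebraMap ℚ (BurnsideRing G))).eval (-1) =
      algebraMap ℚ (BurnsideRing G) (r.eval (-1)) := fun r => by
    rw [show (-1 : BurnsideRing G) = algebraMap ℚ _ (-1) by simp, Polynomial.eval_map_apply]
  rw [Polynomial.eval_mul, Polynomial.eval_mul, hm, hm, ← Algebra.smul_def,
    ← Algebra.smul_def] at hev
  rw [inv_smul_eq_iff₀ hq, smul_comm, hev, inv_smul_smul₀ hq']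

/-- The finite `G`-category `D` has a series Lefschetz invariant. -/
def HasSeriesLefschetz (D : Action Cat.{u, u} G) [Finite D.V] [∀ x y : D.V, Finite (x ⟶ y)] :
    Prop :=
  ∃ L, HasValueAtNegOne (simplexSeries D) L

open Classical in
/-- The series Lefschetz invariant `Λ_Σ(D) = f_D(-1)`. -/
def seriesLefschetz (D : Action Cat.{u, u} G) [Finite D.V] [∀ x y : D.V, Finite (x ⟶ y)] :
    BurnsideRing G :=
  if h : HasSeriesLefschetz D then h.choose else 0

/-- The reduced series Lefschetz invariant `Λ_Σ(D) - [G/G]`. -/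
def reducedSeriesLefschetz [Finite G] (D : Action Cat.{u, u} G) [Finite D.V]
    [∀ x y : D.V, Finite (x ⟶ y)] : BurnsideRing G :=
  seriesLefschetz D - burnsideClass (orbit ⊤)

end Lefschetz

/-! ### The Grothendieck construction of a functor to finite `G`-sets -/

section Grothendieck

variable {G : Type u} [Group G] {C : Type u} [Category.{u} C]

/-- Translation by `g` on the values of `F : C ⥤ G`-sets. -/
def translate (F : C ⥤ FinGSet G) (g : G) : F ⋙ forgetGSet G ⟶ F ⋙ forgetGSet G where
  app x := TypeCat.ofHom (X := F.obj x) (Y := F.obj x) (fun a => g • a)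
  naturality x y f := by
    ext a
    exact (map_smul (show (F.obj x) →[G] (F.obj y) from F.map f) g (show F.obj x from a)).symm

/-- The Grothendieck construction of `F : C ⥤ G`-sets, as a `G`-category: objects are pairs
`(x, a)` with `a ∈ F x`, morphisms `(x, a) ⟶ (y, b)` are morphisms `φ : x ⟶ y` with
`F φ a = b`, and `g • (x, a) = (x, g • a)`. -/
def grothendieck (F : C ⥤ FinGSet G) : Action Cat.{u, u} G where
  V := Cat.of (F ⋙ forgetGSet G).Elements
  ρ :=
    { toFun := fun g => (NatTrans.mapElements (translate F g)).toCatHom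
      map_one' := by
        have : translate F 1 = 𝟙 _ := by
          ext x a
          exact one_smul G (show F.obj x from a)
        rw [this]
        exact Functor.elementsFunctor.map_id _
      map_mul' := fun g h => by
        have : translate F (g * h) = translate F h ≫ translate F g := by
          ext x a
          exact mul_smul g h (show F.obj x from a)
        rw [this]
        exact Functor.elementsFunctor.map_comp _ _ }

instance (F : C ⥤ FinGSet G) [Finite C] : Finite (grothendieck F).V :=
  inferInstanceAs (Finite (Σ x : C, F.obj x))

instance (F : C ⥤ FinGSet G) [∀ x y : C, Finite (x ⟶ y)] (p q : (grothendieck F).V) :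
    Finite (p ⟶ q) :=
  inferInstanceAs (Finite {f : p.1 ⟶ q.1 // ((F ⋙ forgetGSet G).map f) p.2 = q.2})

end Grothendieck

/-! ### Orbit and fusion categories, subgroup and centralizer decomposition categories -/

section Decomposition

variable {G : Type u} [Group G] (S : Set (Subgroup G))

/-- The orbit category of `S`: its objects are the elements of `S`, and the morphisms `H ⟶ K` are
the `G`-maps `G ⧸ H → G ⧸ K`. -/
abbrev OrbitCategory [Finite G] : Type u := InducedCategory (FinGSet G) (fun H : S => orbit H.1)

instance [Finite G] : Finite (OrbitCategory S) := inferInstanceAs (Finite S)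

instance [Finite G] (H K : OrbitCategory S) : Finite (H ⟶ K) :=
  have : Finite (G ⧸ H.1 →[G] G ⧸ K.1) := DFunLike.finite _
  Finite.of_injective
    (fun f : H ⟶ K => (show G ⧸ H.1 →[G] G ⧸ K.1 from f.hom))
    fun _ _ h => InducedCategory.hom_ext h

/-- The subgroup decomposition category `EO_S`: the Grothendieck construction of the inclusion of
the orbit category into finite `G`-sets. -/
abbrev subgroupDecomposition [Finite G] : Action Cat.{u, u} G :=
  grothendieck (inducedFunctor (fun H : S => orbit H.1))

/-- Objects of the fusion category of `S` are the elements of `S`. -/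
structure FusionCategory where
  grp : Subgroup G
  mem : grp ∈ S

variable {S}

/-- Morphisms `H ⟶ K` in the fusion category are the group homomorphisms `H → K` induced by
conjugation by an element of `G`. -/
@[ext]
structure FusionCategory.Hom (H K : FusionCategory S) where
  hom : H.grp →* K.grp
  exists_conj : ∃ g : G, ∀ x : H.grp, (hom x : G) = g * x * g⁻¹

instance : Category.{u} (FusionCategory S) where
  Hom H K := FusionCategory.Hom H K
  id H := ⟨MonoidHom.id _, 1, fun x => by simp⟩
  comp f f' := ⟨f'.hom.comp f.hom, by
    obtain ⟨g, hg⟩ := f.exists_conj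
    obtain ⟨g', hg'⟩ := f'.exists_conj
    exact ⟨g' * g, fun x => by simp [hg, hg', mul_assoc]⟩⟩

instance [Finite G] : Finite (FusionCategory S) :=
  Finite.of_injective (fun H => H.grp) (by rintro ⟨H, _⟩ ⟨K, _⟩ rfl; rfl)

instance [Finite G] (H K : FusionCategory S) : Finite (H ⟶ K) :=
  have : Finite (H.grp →* K.grp) := DFunLike.finite _
  Finite.of_injective (fun f : FusionCategory.Hom H K => f.hom) fun _ _ h =>
    FusionCategory.Hom.ext h

/-- The finite `G`-set `G ⧸ C_G(K)`. -/
abbrev centralizerOrbit [Finite G] (K : Subgroup G) : FinGSet G :=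
  orbit (Subgroup.centralizer (K : Set G))

theorem conj_centralizer {L K : FusionCategory S} (f : L ⟶ K) {g g' : G}
    (hg : ∀ x : L.grp, (f.hom x : G) = g * x * g⁻¹)
    (hg' : ∀ x : L.grp, (f.hom x : G) = g' * x * g'⁻¹) {a b : G}
    (hab : a⁻¹ * b ∈ Subgroup.centralizer (K.grp : Set G)) :
    ((a * g : G) : G ⧸ Subgroup.centralizer (L.grp : Set G)) = (b * g' : G) := by
  rw [QuotientGroup.eq, Subgroup.mem_centralizer_iff]
  intro x hx
  have h1 := hg ⟨x, hx⟩
  have h2 := hg' ⟨x, hx⟩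
  simp only at h1 h2
  have h3 := Subgroup.mem_centralizer_iff.1 hab _ (f.hom ⟨x, hx⟩).2
  have h4 : x = g⁻¹ * (f.hom ⟨x, hx⟩ : G) * g := by rw [h1]; group
  have h5 : (f.hom ⟨x, hx⟩ : G) * g' = g' * x := by rw [h2]; group
  calc x * ((a * g)⁻¹ * (b * g'))
      = g⁻¹ * ((f.hom ⟨x, hx⟩ : G) * (a⁻¹ * b)) * g' := by
        conv_lhs => rw [h4]
        group
    _ = g⁻¹ * (a⁻¹ * b) * ((f.hom ⟨x, hx⟩ : G) * g') := by rw [h3]; group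
    _ = (a * g)⁻¹ * (b * g') * x := by rw [h5]; group

/-- If `f : L ⟶ K` in the fusion category is conjugation by `g`, this is the `G`-map
`G ⧸ C_G(K) → G ⧸ C_G(L)`, `a C_G(K) ↦ a g C_G(L)`. -/
def centralizerMap [Finite G] {L K : FusionCategory S} (f : L ⟶ K) :
    centralizerOrbit K.grp ⟶ centralizerOrbit L.grp :=
  show (G ⧸ Subgroup.centralizer (K.grp : Set G)) →[G]
      (G ⧸ Subgroup.centralizer (L.grp : Set G)) from
  { toFun := Quotient.map' (fun a => a * f.exists_conj.choose) (fun a b hab =>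
      QuotientGroup.leftRel_apply.2 (QuotientGroup.eq.1 (conj_centralizer f
        f.exists_conj.choose_spec f.exists_conj.choose_spec
        (QuotientGroup.leftRel_apply.1 hab))))
    map_smul' := by
      rintro g ⟨a⟩
      exact congrArg QuotientGroup.mk (mul_assoc g a _) }

/-- `centralizerMap f` does not depend on the choice of the conjugating element. -/
theorem centralizerMap_mk [Finite G] {L K : FusionCategory S} (f : L ⟶ K) {g : G}
    (hg : ∀ x : L.grp, (f.hom x : G) = g * x * g⁻¹) (a : G) :
    (show (G ⧸ Subgroup.centralizer (K.grp : Set G)) →[G]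
      (G ⧸ Subgroup.centralizer (L.grp : Set G)) from centralizerMap f) (a : G) = (a * g : G) :=
  conj_centralizer f f.exists_conj.choose_spec hg (by simp)

variable (S)

/-- The functor `v : F_S^op ⥤ G`-sets, `K ↦ G ⧸ C_G(K)`. -/
def centralizerFunctor [Finite G] : (FusionCategory S)ᵒᵖ ⥤ FinGSet G where
  obj K := centralizerOrbit K.unop.grp
  map f := centralizerMap f.unop
  map_id K := by
    refine MulActionHom.ext ?_
    rintro ⟨a⟩
    refine (centralizerMap_mk (𝟙 K.unop) (g := 1) (fun x => ?_) a).trans ?_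
    · change (x : G) = _
      simp
    · rw [mul_one]; rfl
  map_comp {K L M} f f' := by
    refine MulActionHom.ext ?_
    rintro ⟨a⟩
    obtain ⟨g, hg⟩ := f.unop.exists_conj
    obtain ⟨g', hg'⟩ := f'.unop.exists_conj
    refine (centralizerMap_mk (f'.unop ≫ f.unop) (g := g * g') (fun x => ?_) a).trans ?_
    · change (f.unop.hom (f'.unop.hom x) : G) = _
      rw [hg, hg']; group
    · symm
      change (show (G ⧸ Subgroup.centralizer (L.unop.grp : Set G)) →[G]
        (G ⧸ Subgroup.centralizer (M.unop.grp : Set G)) from centralizerMap f'.unop)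
        ((show (G ⧸ Subgroup.centralizer (K.unop.grp : Set G)) →[G]
        (G ⧸ Subgroup.centralizer (L.unop.grp : Set G)) from centralizerMap f.unop) (a : G)) = _
      rw [centralizerMap_mk f.unop hg, centralizerMap_mk f'.unop hg', mul_assoc]

instance [Finite G] : Finite (FusionCategory S)ᵒᵖ := Finite.of_equiv _ Opposite.equivToOpposite

instance [Finite G] (K L : (FusionCategory S)ᵒᵖ) : Finite (K ⟶ L) :=
  Finite.of_injective (fun f => f.unop) Quiver.Hom.unop_inj

/-- The centralizer decomposition category `EA_S`: the Grothendieck construction of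
`v : F_S^op ⥤ G`-sets. -/
abbrev centralizerDecomposition [Finite G] : Action Cat.{u, u} G := grothendieck (centralizerFunctor S)

/-- The poset `S_{>H}` (here `H` need not lie in `S`). -/
abbrev above (H : Subgroup G) : Type u := {K : Subgroup G // K ∈ S ∧ H < K}

/-- The poset `S_{<H}` (here `H` need not lie in `S`). -/
abbrev below (H : Subgroup G) : Type u := {K : Subgroup G // K ∈ S ∧ K < H}

end Decomposition

end

end SeriesLefschetz

open SeriesLefschetz

/-! An element of the rational Burnside ring is determined by its marks, so everything is checked
one mark at a time. Both categories are thin. In `EO` an arrow `(H, x) ⟶ (K, y)` exists exactly when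
the stabilizer of `x` lies in that of `y`. In `EA` the coset `a C_G(K)` stands for the subgroup `a K
a⁻¹`, and arrows are reversed inclusions. Each category is thus a preorder whose underlying poset is
`S`, respectively `S` with the opposite order; an object over `H` has stabilizer `H`, respectively
`C_G(H)`.

The mark at `J` of the simplex series counts chains of consecutively distinct `J`-fixed objects, a
preorder `X` over an up-set `U` of that poset. Write `Y x` for the series counting chains that start
at `x`. Then `Y x = 1 + t (∑_{y ≥ x} Y y - Y x)`, and at `t = -1` this becomes the weighting
equation `∑_{y ≥ x} Y y = 1`. Solving from the top down, the denominators do not vanish at `-1`, and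
the value of the whole series is the total weight of `U` (`ratValue_relChain`).

The function `k H = -χ̃(S_{>H})` (with `S_{<H}` for the opposite order) satisfies a Möbius recursion
making it a weighting on every up-set at once, so each mark is a partial sum of `k`. Averaging over
conjugates shows that the claimed combination of orbits has the same marks (`mark_sum_orbit`).

For the idempotent formula, `U` is the part of `S` above `J`, respectively above `C_G(J)` in the
opposite order, because `J ≤ C_G(H)` iff `H ≤ C_G(J)`. If that subgroup lies in `S`, it is the least
element of `U`, the total weight is 1, and subtracting `[G/G]` leaves 0. Otherwise the recursion
gives `1 - k`, and the reduced mark is `-k`, a reduced Euler characteristic. -/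

namespace SeriesLefschetz

/-! ### Rational series at `-1`, marks by marks -/

/-- A rational power series which is a quotient of polynomials with denominator non-vanishing
at `-1`, with value `v` at `-1`. -/
def RatValueAtNegOne (f : PowerSeries ℚ) (v : ℚ) : Prop :=
  ∃ q p : Polynomial ℚ, q.eval (-1) ≠ 0 ∧ (q : PowerSeries ℚ) * f = p ∧
    v * q.eval (-1) = p.eval (-1)

theorem RatValueAtNegOne.coe (p : Polynomial ℚ) :
    RatValueAtNegOne (p : PowerSeries ℚ) (p.eval (-1)) :=
  ⟨1, p, by simp, by simp, by simp⟩

theorem RatValueAtNegOne.add {f g : PowerSeries ℚ} {v w : ℚ} (hf : RatValueAtNegOne f v)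
    (hg : RatValueAtNegOne g w) : RatValueAtNegOne (f + g) (v + w) := by
  obtain ⟨q, p, h0, h1, h2⟩ := hf
  obtain ⟨q', p', h0', h1', h2'⟩ := hg
  refine ⟨q * q', p * q' + p' * q, by simp [h0, h0'], ?_, ?_⟩
  · push_cast
    rw [← h1, ← h1']; ring
  · simp only [Polynomial.eval_add, Polynomial.eval_mul, ← h2, ← h2']; ring

theorem RatValueAtNegOne.mul {f g : PowerSeries ℚ} {v w : ℚ} (hf : RatValueAtNegOne f v)
    (hg : RatValueAtNegOne g w) : RatValueAtNegOne (f * g) (v * w) := by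
  obtain ⟨q, p, h0, h1, h2⟩ := hf
  obtain ⟨q', p', h0', h1', h2'⟩ := hg
  refine ⟨q * q', p * p', by simp [h0, h0'], ?_, ?_⟩
  · push_cast
    rw [← h1, ← h1']; ring
  · simp only [Polynomial.eval_mul, ← h2, ← h2']; ring

theorem RatValueAtNegOne.sum {ι : Type*} (s : Finset ι) {f : ι → PowerSeries ℚ} {v : ι → ℚ}
    (h : ∀ i ∈ s, RatValueAtNegOne (f i) (v i)) :
    RatValueAtNegOne (∑ i ∈ s, f i) (∑ i ∈ s, v i) := by
  classical
  induction s using Finset.induction_on with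
  | empty => simpa using RatValueAtNegOne.coe 0
  | insert a s ha ih =>
    rw [Finset.sum_insert ha, Finset.sum_insert ha]
    exact (h a (Finset.mem_insert_self a s)).add
      (ih fun i hi => h i (Finset.mem_insert_of_mem hi))

/-- Solves a linear equation for a series: dividing by a polynomial that does not vanish at `-1`
keeps the series regular there. -/
theorem RatValueAtNegOne.of_mul_left {f : PowerSeries ℚ} {w v : ℚ} {r : Polynomial ℚ}
    (hr : r.eval (-1) ≠ 0) (h : RatValueAtNegOne ((r : PowerSeries ℚ) * f) w)
    (hv : r.eval (-1) * v = w) : RatValueAtNegOne f v := by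
  obtain ⟨q, p, h0, h1, h2⟩ := h
  refine ⟨q * r, p, by simp [h0, hr], ?_, ?_⟩
  · push_cast
    rw [← h1]; ring
  · rw [← h2, Polynomial.eval_mul, ← hv]; ring

/-- A power series over the Burnside ring has the value `L` at `-1` as soon as its marks have the
marks of `L` as values. -/
theorem hasValueAtNegOne_of_marks {G : Type u} [Group G] [Finite G]
    (f : PowerSeries (BurnsideRing G)) (L : BurnsideRing G)
    (h : ∀ K : Subgroup G,
      RatValueAtNegOne (PowerSeries.map (mark K : BurnsideRing G →+* ℚ) f) (mark K L)) :
    HasValueAtNegOne f L := by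
  classical
  have := Fintype.ofFinite (Subgroup G)
  choose q p hq hqf hv using h
  -- There are finitely many subgroups, so one common denominator serves all marks.
  set Q : Polynomial ℚ := ∏ K, q K with hQ
  have hQ0 : Q.eval (-1) ≠ 0 := by
    rw [hQ, Polynomial.eval_prod]
    exact Finset.prod_ne_zero_iff.2 fun K _ => hq K
  set F : PowerSeries (BurnsideRing G) :=
    ((Q.map (algebraMap ℚ (BurnsideRing G)) : Polynomial (BurnsideRing G)) :
      PowerSeries (BurnsideRing G)) * f with hF
  have hmark : ∀ K : Subgroup G, (mark K : BurnsideRing G →+* ℚ).comp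
      (algebraMap ℚ (BurnsideRing G)) = RingHom.id ℚ := fun K => by
    ext x
    exact (mark K).commutes x
  set P : Subgroup G → Polynomial ℚ := fun K => (∏ J ∈ Finset.univ.erase K, q J) * p K with hP
  have hQK : ∀ K, Q = (∏ J ∈ Finset.univ.erase K, q J) * q K := fun K => by
    rw [hQ, Finset.prod_erase_mul _ _ (Finset.mem_univ K)]
  have hFP : ∀ K, PowerSeries.map (mark K : BurnsideRing G →+* ℚ) F = (P K : PowerSeries ℚ) := by
    intro K
    rw [hF, map_mul, ← Polynomial.polynomial_map_coe, Polynomial.map_map, hmark, Polynomial.map_id,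
      hQK K, hP, Polynomial.coe_mul, Polynomial.coe_mul, mul_assoc, hqf]
  set N := Finset.univ.sup (fun K => (P K).natDegree) with hN
  -- Beyond the largest degree `N` of the numerators, each coefficient of `Q f` has all marks zero.
  -- So `Q f` is a polynomial over the Burnside ring, namely its own truncation.
  have hbig : ∀ n, N < n → PowerSeries.coeff n F = 0 := by
    intro n hn
    refine eq_zero_of_marks _ fun K => ?_
    have h1 := congrArg (PowerSeries.coeff n) (hFP K)
    rw [PowerSeries.coeff_map, Polynomial.coeff_coe,
      Polynomial.coeff_eq_zero_of_natDegree_lt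
        ((Finset.le_sup (f := fun K => (P K).natDegree) (Finset.mem_univ K)).trans_lt hn)] at h1
    exact h1
  have hFt : ((PowerSeries.trunc (N + 1) F : Polynomial (BurnsideRing G)) :
      PowerSeries (BurnsideRing G)) = F := by
    ext n
    rw [Polynomial.coeff_coe, PowerSeries.coeff_trunc]
    split_ifs with hn
    · rfl
    · exact (hbig n (by omega)).symm
  refine ⟨Q, PowerSeries.trunc (N + 1) F, hQ0, hFt.symm, ?_⟩
  refine sub_eq_zero.1 (eq_zero_of_marks _ fun K => ?_)
  have hmap : (PowerSeries.trunc (N + 1) F).map (mark K : BurnsideRing G →+* ℚ) = P K := by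
    apply Polynomial.coe_injective
    rw [Polynomial.polynomial_map_coe, hFt, hFP]
  have hev : mark K ((PowerSeries.trunc (N + 1) F).eval (-1)) = (P K).eval (-1) := by
    rw [← hmap, show (-1 : ℚ) = (mark K : BurnsideRing G →+* ℚ) (-1) by simp,
      Polynomial.eval_map_apply]
    rfl
  rw [map_sub, map_smul, hev, sub_eq_zero, smul_eq_mul, eq_inv_mul_iff_mul_eq₀ hQ0, hQK K, hP]
  simp only [Polynomial.eval_mul, ← hv]
  ring

theorem HasValueAtNegOne.seriesLefschetz_eq {G : Type u} [Group G] {D : Action Cat.{u, u} G}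
    [Finite D.V] [∀ x y : D.V, Finite (x ⟶ y)] {L : BurnsideRing G}
    (h : HasValueAtNegOne (simplexSeries D) L) : seriesLefschetz D = L := by
  have hD : HasSeriesLefschetz D := ⟨L, h⟩
  rw [seriesLefschetz, dif_pos hD]
  exact hD.choose_spec.unique h

-- An idempotent `e` with marks 1 exactly on the conjugacy class of `H` multiplies the primitive
-- idempotent to 0 or to itself. The mark at `H` excludes 0, so the primitive idempotent has no mark
-- outside the class.
open Classical in
theorem mark_primIdempotent {G : Type u} [Group G] [Finite G] (H K : Subgroup G) :
    mark K (primIdempotent H) = if ConjSubgroups H K then 1 else 0 := by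
  obtain ⟨⟨hid, -, hprim⟩, hH⟩ :
      IsPrimitiveIdempotent (primIdempotent H) ∧ mark H (primIdempotent H) = 1 :=
    (existsUnique_primitiveIdempotent H).choose_spec.1
  split_ifs with hK
  · rw [← mark_conj hK, hH]
  · obtain ⟨e, he⟩ := exists_idempotent_marks H
    have heid : IsIdempotentElem e := sub_eq_zero.1 (eq_zero_of_marks _ fun K => by
      rw [map_sub, map_mul, he]; split_ifs <;> simp)
    rcases hprim (e * primIdempotent H) (heid.mul hid) (by rw [mul_assoc, hid]) with h0 | h0
    · have := congrArg (mark H) h0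
      rw [map_mul, hH, he, if_pos ⟨1, by simp⟩, map_zero] at this
      simp at this
    · rw [← h0, map_mul, he, if_neg hK, zero_mul]

/-! ### Chains in a finite set -/

section Chains

variable {X : Type*} [Fintype X]

/-- Sequences `x_0, …, x_n` with `r x_i x_{i+1}` for all `i < n`. -/
abbrev RelChain (r : X → X → Prop) (n : ℕ) : Type _ :=
  {o : Fin (n + 1) → X // ∀ i : Fin n, r (o i.castSucc) (o i.succ)}

/-- The number of `r`-chains of length `n` starting at a given point. -/
def chainCount (r : X → X → Prop) [DecidableRel r] : ℕ → X → ℚ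
  | 0, _ => 1
  | n + 1, x => ∑ y, if r x y then chainCount r n y else 0

/-- Splitting off the first vertex turns a chain of length `n + 1` from `x` into a successor `y` of
`x` and a chain of length `n` from `y`. -/
theorem card_relChain_start (r : X → X → Prop) [DecidableRel r] (n : ℕ) (x : X) :
    (Nat.card {o : RelChain r n // o.1 0 = x} : ℚ) = chainCount r n x := by
  classical
  induction n generalizing x with
  | zero =>
    rw [chainCount, Nat.cast_eq_one, Nat.card_eq_one_iff_unique]
    refine ⟨⟨fun a b => Subtype.ext (Subtype.ext (funext fun i => ?_))⟩,
      ⟨⟨⟨fun _ => x, fun i => i.elim0⟩, rfl⟩⟩⟩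
    rw [Subsingleton.elim (α := Fin 1) i 0, a.2, b.2]
  | succ n ih =>
    have e : {o : RelChain r (n + 1) // o.1 0 = x} ≃
        Σ y : {y : X // r x y}, {o : RelChain r n // o.1 0 = y} :=
      { toFun := fun o => ⟨⟨o.1.1 1, by simpa [o.2] using o.1.2 0⟩,
          ⟨⟨fun i => o.1.1 i.succ, fun i => o.1.2 i.succ⟩, rfl⟩⟩
        invFun := fun o => ⟨⟨Fin.cons x o.2.1.1, fun i => by
          refine Fin.cases ?_ (fun j => ?_) i
          · simpa [o.2.2] using o.1.2
          · simpa using o.2.1.2 j⟩, rfl⟩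
        left_inv := by
          rintro ⟨⟨o, ho⟩, rfl⟩
          refine Subtype.ext (Subtype.ext ?_)
          exact Fin.cons_self_tail o
        right_inv := by
          rintro ⟨⟨y, hy⟩, ⟨⟨o, ho⟩, h⟩⟩
          obtain rfl : o 0 = y := h
          rfl }
    rw [Nat.card_congr e, Nat.card_sigma, chainCount, Nat.cast_sum, ← Finset.sum_filter,
      Finset.sum_subtype (p := fun y => r x y) _ (by simp)]
    exact Finset.sum_congr rfl fun y _ => ih y.1

theorem card_relChain (r : X → X → Prop) [DecidableRel r] (n : ℕ) :
    (Nat.card (RelChain r n) : ℚ) = ∑ x, chainCount r n x := by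
  rw [← Nat.card_congr (Equiv.sigmaFiberEquiv fun o : RelChain r n => o.1 0), Nat.card_sigma,
    Nat.cast_sum]
  exact Finset.sum_congr rfl fun x _ => card_relChain_start r n x

/-- The value at `-1` of the series counting the non-degenerate simplices of a finite preorder,
presented as a surjection `c` onto a finite poset with weighting `k`. -/
theorem ratValue_relChain {P : Type*} [PartialOrder P] [Fintype P] [DecidableLE P] (c : X → P)
    (hc : Function.Surjective c) (k : P → ℚ) (hk : ∀ p, ∑ q with p ≤ q, k q = 1) :
    RatValueAtNegOne (PowerSeries.mk fun n =>
      (Nat.card (RelChain (fun x y : X => c x ≤ c y ∧ x ≠ y) n) : ℚ)) (∑ p, k p) := by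
  classical
  set r : X → X → Prop := fun x y => c x ≤ c y ∧ x ≠ y with hr
  set Y : X → PowerSeries ℚ := fun x => PowerSeries.mk fun n => chainCount r n x with hY
  set m : P → ℚ := fun p => (Finset.univ.filter fun x => c x = p).card with hm
  have hm0 : ∀ p, m p ≠ 0 := fun p => by
    obtain ⟨x, hx⟩ := hc p
    rw [hm, Nat.cast_ne_zero, Finset.card_ne_zero]
    exact ⟨x, by simpa using hx⟩
  -- The condition `x ≠ y` removes the single term `y = x` from the sum over `c x ≤ c y`.
  have hrec : ∀ n x, chainCount r (n + 1) x =
      (∑ y, if c x ≤ c y then chainCount r n y else 0) - chainCount r n x := by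
    intro n x
    rw [chainCount, eq_sub_iff_add_eq]
    have : chainCount r n x = ∑ y, if y = x then chainCount r n y else 0 := by simp
    conv_lhs => rw [this]
    rw [← Finset.sum_add_distrib]
    refine Finset.sum_congr rfl fun y _ => ?_
    rcases eq_or_ne y x with rfl | hne
    · simp [hr]
    · simp [hr, hne, hne.symm]
  -- The recursion sees `x` only through `c x` and the previous count, so counts are constant on
  -- fibres of `c`, and one representative `s p` per fibre suffices.
  have hconst : ∀ n x y, c x = c y → chainCount r n x = chainCount r n y := by
    intro n
    induction n with
    | zero => intro x y _; rfl
    | succ n ih => intro x y h; rw [hrec, hrec, h, ih x y h]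
  have hYconst : ∀ x y, c x = c y → Y x = Y y := fun x y h => by
    ext n; simpa [hY] using hconst n x y h
  obtain ⟨s, hs⟩ := hc.hasRightInverse
  have hYs : ∀ x, Y x = Y (s (c x)) := fun x => hYconst _ _ (hs (c x)).symm
  have hfib : ∀ (p : P → Prop) [DecidablePred p], (∑ x, if p (c x) then Y x else 0) =
      ∑ q with p q, PowerSeries.C (m q) * Y (s q) := by
    intro p _
    rw [← Finset.sum_filter, ← Finset.sum_fiberwise_of_maps_to (g := c) (t := Finset.univ.filter p)
      (fun x hx => by simpa using hx)]
    refine Finset.sum_congr rfl fun q hq => ?_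
    rw [Finset.filter_filter, Finset.sum_congr rfl (g := fun _ => Y (s q))]
    · rw [Finset.sum_const, hm, nsmul_eq_mul, map_natCast]
      congr 3
      ext x
      simp only [Finset.mem_filter, Finset.mem_univ, true_and, and_iff_right_iff_imp]
      rintro rfl
      simpa using hq
    · intro x hx
      rw [hYs, (Finset.mem_filter.1 hx).2.2]
  -- At `t = -1` the two terms `Y x` cancel, leaving the weighting equation on the preorder `X`.
  have hYrec : ∀ x, Y x = 1 + PowerSeries.X * ((∑ y, if c x ≤ c y then Y y else 0) - Y x) := by
    intro x
    ext n
    cases n with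
    | zero => simp [hY, chainCount]
    | succ n =>
      rw [map_add, PowerSeries.coeff_succ_X_mul, map_sub, map_sum]
      simp only [hY, PowerSeries.coeff_mk, hrec, PowerSeries.coeff_one, Nat.succ_ne_zero, if_false,
        zero_add, apply_ite (PowerSeries.coeff n), map_zero]
  -- Downward induction on `P`: the weight `k p` is shared equally by the `m p` points of the fibre
  -- over `p`.
  have hval : ∀ p, RatValueAtNegOne (Y (s p)) ((m p)⁻¹ * k p) := by
    intro p
    induction p using (wellFounded_gt (α := P)).induction with
    | _ p ih =>
      have hsplit : Finset.univ.filter (fun q => p ≤ q) =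
          insert p (Finset.univ.filter fun q => p < q) := by
        ext q
        simp [le_iff_eq_or_lt, eq_comm]
      have hsum := RatValueAtNegOne.sum (Finset.univ.filter fun q => p < q)
        (f := fun q => PowerSeries.C (m q) * Y (s q)) (v := k) fun q hq => by
          have h1 := ih q (by simpa using hq)
          have h2 := RatValueAtNegOne.coe (Polynomial.C (m q))
          rw [Polynomial.coe_C, Polynomial.eval_C] at h2
          have h3 := h2.mul h1
          rwa [mul_inv_cancel_left₀ (hm0 q)] at h3
      have h1 := RatValueAtNegOne.coe 1
      have hX := RatValueAtNegOne.coe Polynomial.X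
      rw [Polynomial.coe_one, Polynomial.eval_one] at h1
      rw [Polynomial.coe_X, Polynomial.eval_X] at hX
      have htot := h1.add (hX.mul hsum)
      -- The factor collects the terms in `Y (s p)`: one from each side of `hYrec` and `m p` from
      -- the fibre of `p` itself. Its value at `-1` is `m p`, nonzero because `c` is surjective.
      refine RatValueAtNegOne.of_mul_left
        (r := 1 + Polynomial.X - Polynomial.X * Polynomial.C (m p)) (w := m p * ((m p)⁻¹ * k p))
        (by simpa using hm0 p) ?_ (by simp)
      have hkp := hk p
      rw [hsplit, Finset.sum_insert (by simp)] at hkp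
      have hw : (1 : ℚ) + -1 * ∑ q with p < q, k q = m p * ((m p)⁻¹ * k p) := by
        rw [mul_inv_cancel_left₀ (hm0 p)]; linarith
      rw [← hw]
      convert htot using 1
      have := hYrec (s p)
      rw [hs p, hfib (fun q => p ≤ q), hsplit, Finset.sum_insert (by simp)] at this
      push_cast
      linear_combination this
  have htotal := RatValueAtNegOne.sum Finset.univ
    (f := fun q => PowerSeries.C (m q) * Y (s q)) (v := k) fun q _ => by
      have h2 := RatValueAtNegOne.coe (Polynomial.C (m q))
      rw [Polynomial.coe_C, Polynomial.eval_C] at h2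
      have h3 := h2.mul (hval q)
      rwa [mul_inv_cancel_left₀ (hm0 q)] at h3
  convert htotal using 1
  have := hfib (fun _ => True)
  simp only [if_true, Finset.filter_true] at this
  rw [← this]
  ext n
  rw [map_sum]
  simp only [hY, PowerSeries.coeff_mk]
  exact card_relChain r n

end Chains

/-! ### Thin `G`-categories -/

section Thin

variable {G : Type u} [Group G]

/-- In a thin `G`-category, the `K`-fixed non-degenerate simplices are the chains of pairwise
consecutively distinct `K`-fixed objects. -/
theorem fixedCard_nondegSimplex {T : Type*} [PartialOrder T] (D : Action Cat.{u, u} G)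
    [Finite D.V] [∀ x y : D.V, Finite (x ⟶ y)] [Quiver.IsThin D.V] (c : D.V → T)
    (hc : ∀ x y : D.V, Nonempty (x ⟶ y) ↔ c x ≤ c y) (K : Subgroup G) (n : ℕ) :
    fixedCard K (FinGSet.of (NondegSimplex D.V n)) =
      Nat.card (RelChain (fun x y : {x : D.V // ∀ g ∈ K, (D.ρ g).toFunctor.obj x = x} =>
        c x ≤ c y ∧ x ≠ y) n) := by
  -- In a thin category a simplex is determined by its vertices, so it is fixed by `K` exactly when
  -- each vertex is.
  have hext : ∀ σ τ : ComposableArrows D.V n, (∀ i, σ.obj i = τ.obj i) → σ = τ := fun σ τ h =>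
    CategoryTheory.Functor.ext h fun _ _ _ => Subsingleton.elim _ _
  have hid : ∀ {x y : D.V} (f : x ⟶ y), IsIdentity f ↔ x = y := fun f =>
    ⟨fun h => h.1, fun h => ⟨h, Subsingleton.elim _ _⟩⟩
  have hfix : ∀ σ : {σ : NondegSimplex D.V n // ∀ g ∈ K, g • σ = σ}, ∀ i, ∀ g ∈ K,
      (D.ρ g).toFunctor.obj (σ.1.1.obj i) = σ.1.1.obj i := fun σ i g hg =>
    congrArg (fun τ : NondegSimplex D.V n => τ.1.obj i) (σ.2 g hg)
  let e : {σ : NondegSimplex D.V n // ∀ g ∈ K, g • σ = σ} →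
      RelChain (fun x y : {x : D.V // ∀ g ∈ K, (D.ρ g).toFunctor.obj x = x} =>
        c x ≤ c y ∧ x ≠ y) n := fun σ =>
    ⟨fun i => ⟨σ.1.1.obj i, hfix σ i⟩, fun i =>
      ⟨(hc _ _).1 ⟨σ.1.1.map (homOfLE (Fin.castSucc_lt_succ (i := i)).le)⟩,
        fun h => σ.1.2 i i.2 ((hid _).2 (congrArg Subtype.val h))⟩⟩
  refine Nat.card_congr (Equiv.ofBijective e ⟨?_, ?_⟩)
  · intro σ τ h
    refine Subtype.ext (Subtype.ext (hext _ _ fun i => ?_))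
    exact congrArg Subtype.val (congrFun (congrArg Subtype.val h) i)
  · rintro ⟨o, ho⟩
    have hmono : Monotone fun i => c (o i).1 := Fin.monotone_iff_le_succ.2 fun i => (ho i).1
    -- Thinness makes any choice of arrows functorial.
    let σ : ComposableArrows D.V n :=
      { obj := fun i => (o i).1
        map := fun {i j} f => ((hc _ _).2 (hmono (leOfHom f))).some
        map_id := fun _ => Subsingleton.elim _ _
        map_comp := fun _ _ => Subsingleton.elim _ _ }
    refine ⟨⟨⟨σ, fun i hi h => (ho ⟨i, hi⟩).2 (Subtype.ext ((hid _).1 h))⟩, fun g hg => ?_⟩, rfl⟩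
    exact Subtype.ext (hext _ _ fun i => (o i).2 g hg)

/-- The value at `-1` of the marks of the simplex series of a thin finite `G`-category whose
`K`-fixed part is a preorder with underlying poset `U`. -/
theorem ratValue_mark_simplexSeries {T : Type*} [PartialOrder T] [Fintype T] [DecidableLE T]
    (D : Action Cat.{u, u} G) [Finite D.V] [∀ x y : D.V, Finite (x ⟶ y)] [Quiver.IsThin D.V]
    (c : D.V → T) (hc : ∀ x y : D.V, Nonempty (x ⟶ y) ↔ c x ≤ c y) (K : Subgroup G)
    (U : T → Prop) [DecidablePred U]
    (hU : ∀ x : D.V, (∀ g ∈ K, (D.ρ g).toFunctor.obj x = x) ↔ U (c x))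
    (hsurj : ∀ t, U t → ∃ x, c x = t) (k : T → ℚ)
    (hk : ∀ t, U t → ∑ s with U s ∧ t ≤ s, k s = 1) :
    RatValueAtNegOne (PowerSeries.map (mark K : BurnsideRing G →+* ℚ) (simplexSeries D))
      (∑ t with U t, k t) := by
  have := Fintype.ofFinite {x : D.V // ∀ g ∈ K, (D.ρ g).toFunctor.obj x = x}
  have key := ratValue_relChain (P := {t // U t})
    (fun x : {x : D.V // ∀ g ∈ K, (D.ρ g).toFunctor.obj x = x} =>
      (⟨c x.1, (hU _).1 x.2⟩ : {t // U t}))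
    (fun t => by
      obtain ⟨x, hx⟩ := hsurj t.1 t.2
      exact ⟨⟨x, (hU x).2 (hx ▸ t.2)⟩, Subtype.ext hx⟩)
    (fun t => k t.1) (fun t => by
      rw [← hk t.1 t.2, ← Finset.filter_filter,
        Finset.sum_filter, Finset.sum_filter (s := Finset.filter U _),
        ← Finset.sum_subtype_eq_sum_filter, Finset.subtype_univ]
      rfl)
  rw [← Finset.sum_subtype_eq_sum_filter, Finset.subtype_univ]
  convert key using 1
  ext n
  rw [PowerSeries.coeff_map, simplexSeries, PowerSeries.coeff_mk, PowerSeries.coeff_mk]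
  refine (mark_burnsideClass K _).trans ?_
  rw [fixedCard_nondegSimplex D c hc K n]
  rfl

end Thin

/-! ### Poset weightings -/

section Weight

variable {P : Type u} [PartialOrder P] [Fintype P] [DecidableLE P]

theorem eulerChar_eq_sum_of_ge (k : P → ℚ) (hk : ∀ x, ∑ y with x ≤ y, k y = 1) :
    eulerChar P = ∑ x, k x := by
  obtain ⟨-, l, hl⟩ := hasEulerChar_poset P
  rw [eulerChar_eq_weighting (k := k) _ hl, finsum_eq_sum_of_fintype]
  intro x
  rw [finsum_eq_sum_of_fintype, ← hk x, Finset.sum_filter]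
  simp only [natCard_poset_hom, ite_mul, one_mul, zero_mul]

theorem eulerChar_eq_sum_of_le (k : P → ℚ) (hk : ∀ x, ∑ y with y ≤ x, k y = 1) :
    eulerChar P = ∑ x, k x := by
  obtain ⟨⟨l, hl⟩, -⟩ := hasEulerChar_poset P
  have hk' : IsCoweighting P k := by
    intro x
    rw [finsum_eq_sum_of_fintype, ← hk x, Finset.sum_filter]
    simp only [natCard_poset_hom, mul_ite, mul_one, mul_zero]
  rw [eulerChar_eq_weighting hl hk', sum_weighting_eq_sum_coweighting hl hk',
    finsum_eq_sum_of_fintype]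

end Weight

/-! ### Möbius weights and reduced Euler characteristics -/

section Mobius

theorem sum_subtype_filter {P M : Type*} [Fintype P] [AddCommMonoid M] (p q : P → Prop) [DecidablePred p]
    [DecidablePred q] (f : P → M) :
    ∑ y : {y // p y} with q y.1, f y.1 = ∑ y with p y ∧ q y, f y := by
  rw [← Finset.filter_filter, Finset.sum_filter, Finset.sum_filter (s := Finset.filter p _),
    ← Finset.sum_subtype_eq_sum_filter, Finset.subtype_univ]

variable {P : Type u} [PartialOrder P] [Fintype P]

open Classical in
/-- `k` restricts to a weighting on every up-set of `S`. -/
def IsMobiusWeight (S : Set P) (k : P → ℚ) : Prop :=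
  ∀ x, k x = 1 - ∑ y with y ∈ S ∧ x < y, k y

theorem exists_isMobiusWeight (S : Set P) : ∃ k : P → ℚ, IsMobiusWeight S k := by
  classical
  have wf : WellFounded ((· > ·) : P → P → Prop) := wellFounded_gt
  refine ⟨wf.fix fun x ih => 1 - ∑ y, if h : y > x then (if y ∈ S then ih y h else 0) else 0,
    fun x => ?_⟩
  rw [wf.fix_eq, Finset.sum_filter]
  congr 1
  refine Finset.sum_congr rfl fun y _ => ?_
  by_cases h : x < y <;> by_cases h' : y ∈ S <;> simp [h, h']

theorem IsMobiusWeight.unique {S : Set P} {k l : P → ℚ} (hk : IsMobiusWeight S k)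
    (hl : IsMobiusWeight S l) (x : P) : k x = l x := by
  classical
  induction x using (wellFounded_gt (α := P)).induction with
  | _ x ih =>
    rw [hk x, hl x]
    congr 1
    exact Finset.sum_congr rfl fun y hy => ih y (Finset.mem_filter.1 hy).2.2

/-- The recursion determines `k`, so every order automorphism preserving `S` preserves it. Applied
to conjugation, this makes the weights class functions. -/
theorem IsMobiusWeight.map_orderIso {S : Set P} {k : P → ℚ} (hk : IsMobiusWeight S k)
    (φ : P ≃o P) (hφ : ∀ x, φ x ∈ S ↔ x ∈ S) (x : P) : k (φ x) = k x := by
  classical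
  refine IsMobiusWeight.unique (S := S) (k := fun x => k (φ x)) (fun x => ?_) hk x
  refine (hk (φ x)).trans ?_
  congr 1
  symm
  refine Finset.sum_equiv φ.toEquiv (fun y => ?_) fun _ _ => rfl
  simp [hφ]

open Classical in
theorem IsMobiusWeight.sum_ge {S : Set P} {k : P → ℚ} (hk : IsMobiusWeight S k) {x : P}
    (hx : x ∈ S) : ∑ y with y ∈ S ∧ x ≤ y, k y = 1 := by
  have : Finset.univ.filter (fun y => y ∈ S ∧ x ≤ y) =
      insert x (Finset.univ.filter fun y => y ∈ S ∧ x < y) := by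
    ext y
    rcases eq_or_ne y x with rfl | hne
    · simp [hx]
    · simp [hne, lt_iff_le_and_ne, hne.symm]
  rw [this, Finset.sum_insert (by simp), hk x]
  ring

-- Off `S` the value `k x` is not part of the sum; it measures how far the total weight of the
-- up-set above `x` is from 1. This is where the idempotent coefficients come from.
open Classical in
theorem IsMobiusWeight.sum_ge_of_notMem {S : Set P} {k : P → ℚ} (hk : IsMobiusWeight S k) {x : P}
    (hx : x ∉ S) : ∑ y with y ∈ S ∧ x ≤ y, k y = 1 - k x := by
  rw [hk x, sub_sub_cancel]
  refine Finset.sum_congr (Finset.filter_congr fun y _ => and_congr_right fun hy => ?_)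
    fun _ _ => rfl
  exact ⟨fun h => lt_of_le_of_ne h fun he => hx (he ▸ hy), le_of_lt⟩

/-- On the up-set of elements of `S` above `x`, `k` is a weighting, so the sum in the recursion is
an Euler characteristic. -/
theorem IsMobiusWeight.eq_above {S : Set P} {k : P → ℚ} (hk : IsMobiusWeight S k) (x : P) :
    k x = -reducedEulerChar {y : P // y ∈ S ∧ x < y} := by
  classical
  have h := eulerChar_eq_sum_of_ge (P := {y : P // y ∈ S ∧ x < y}) (fun y => k y.1) fun y => by
    rw [← hk.sum_ge y.2.1]
    refine (sum_subtype_filter (fun z => z ∈ S ∧ x < z) (fun z => y.1 ≤ z) k).trans ?_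
    refine Finset.sum_congr (Finset.filter_congr fun z _ => ?_) fun _ _ => rfl
    exact ⟨fun h => ⟨h.1.1, h.2⟩, fun h => ⟨⟨h.1, y.2.2.trans_le h.2⟩, h.2⟩⟩
  rw [reducedEulerChar, h, hk x, ← Finset.sum_subtype_eq_sum_filter, Finset.subtype_univ]
  ring

/-- A weighting for the reversed order is a coweighting for the original one, and both have the
Euler characteristic as total. -/
theorem IsMobiusWeight.eq_below {S : Set P} {k : Pᵒᵈ → ℚ}
    (hk : IsMobiusWeight (OrderDual.ofDual ⁻¹' S) k) (x : P) :
    k (OrderDual.toDual x) = -reducedEulerChar {y : P // y ∈ S ∧ y < x} := by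
  classical
  have h := eulerChar_eq_sum_of_le (P := {y : P // y ∈ S ∧ y < x})
    (fun y => k (OrderDual.toDual y.1)) fun y => by
      rw [← hk.sum_ge (x := OrderDual.toDual y.1) y.2.1]
      refine (sum_subtype_filter (fun z => z ∈ S ∧ z < x) (fun z => z ≤ y.1)
        fun z => k (OrderDual.toDual z)).trans ?_
      refine Finset.sum_congr (Finset.ext fun z => ?_) fun _ _ => rfl
      rw [Finset.mem_filter_univ]
      refine Iff.trans ?_ (Finset.mem_filter_univ (α := Pᵒᵈ) z).symm
      exact ⟨fun h => ⟨h.1.1, h.2⟩, fun h => ⟨⟨h.1, lt_of_le_of_lt h.2 y.2.2⟩, h.2⟩⟩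
  rw [reducedEulerChar, h, hk, ← Finset.sum_subtype_eq_sum_filter, Finset.subtype_univ, neg_sub]
  rfl

end Mobius

/-! ### Marks of averaged orbits and idempotents -/

section Marks

variable {G : Type u} [Group G]

/-- The coset `aH` is fixed by `J` iff `J ≤ a H a⁻¹`, and each fixed coset has `|H|` representatives
`a`. -/
theorem natCard_fixed_mul_natCard [Finite G] (J H : Subgroup G) :
    fixedCard J (orbit H) * Nat.card H = Nat.card {a : G // J ≤ MulAut.conj a • H} := by
  have hfix : ∀ a : G, (∀ j ∈ J, j • (a : G ⧸ H) = a) ↔ J ≤ MulAut.conj a • H := fun a => by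
    refine forall₂_congr fun j _ => ?_
    rw [mem_conj_smul, eq_comm, MulAction.Quotient.smul_coe, QuotientGroup.eq, smul_eq_mul,
      mul_assoc]
  rw [fixedCard, mul_comm, ← Nat.card_prod]
  exact Nat.card_congr ((QuotientGroup.preimageMkEquivSubgroupProdSet H
    {x : G ⧸ H | ∀ j ∈ J, j • x = x}).symm.trans (Equiv.subtypeEquivRight hfix))

open Classical in
/-- Averaging over conjugates: the marks of `∑_H k(H) / |G : N(H)| • [G / N(H)]`. -/
theorem mark_sum_orbit [Finite G] [Fintype (Subgroup G)] (S : Set (Subgroup G))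
    (hS : ∀ (g : G) (H : Subgroup G), MulAut.conj g • H ∈ S ↔ H ∈ S)
    (N : Subgroup G → Subgroup G)
    (hN : ∀ (g : G) (H : Subgroup G), N (MulAut.conj g • H) = MulAut.conj g • N H)
    (k : Subgroup G → ℚ) (hk : ∀ (g : G) (H : Subgroup G), k (MulAut.conj g • H) = k H)
    (J : Subgroup G) :
    mark J (∑ H with H ∈ S, (k H / ((N H).index : ℚ)) • burnsideClass (orbit (N H))) =
      ∑ H with H ∈ S ∧ J ≤ N H, k H := by
  have := Fintype.ofFinite G
  have hG : (Nat.card G : ℚ) ≠ 0 := Nat.cast_ne_zero.2 Nat.card_pos.ne'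
  -- Counting elements `a` of `G` instead of cosets replaces the index by the uniform factor `1 /
  -- |G|`.
  have h1 : ∀ H : Subgroup G, k H / ((N H).index : ℚ) * fixedCard J (orbit (N H)) =
      (Nat.card G : ℚ)⁻¹ * ∑ a : G, if J ≤ N (MulAut.conj a • H) then k H else 0 := by
    intro H
    have hi : (Nat.card (N H) : ℚ) * (N H).index = Nat.card G := by
      exact_mod_cast (N H).card_mul_index
    have hi1 : (Nat.card (N H) : ℚ) ≠ 0 := Nat.cast_ne_zero.2 Nat.card_pos.ne'
    have hi2 : ((N H).index : ℚ) ≠ 0 := Nat.cast_ne_zero.2 Subgroup.index_ne_zero_of_finite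
    have hf : (fixedCard J (orbit (N H)) : ℚ) * Nat.card (N H) =
        Nat.card {a : G // J ≤ MulAut.conj a • N H} := by
      exact_mod_cast natCard_fixed_mul_natCard J (N H)
    have hs : (∑ a : G, if J ≤ N (MulAut.conj a • H) then k H else 0) =
        Nat.card {a : G // J ≤ MulAut.conj a • N H} * k H := by
      rw [← Finset.sum_filter, Finset.sum_const, nsmul_eq_mul, Nat.card_eq_fintype_card,
        Fintype.card_subtype]
      simp only [hN]
    rw [hs, ← hf, ← hi]
    field_simp
  rw [map_sum]
  simp only [map_smul, mark_burnsideClass, smul_eq_mul, h1]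
  rw [← Finset.mul_sum, Finset.sum_comm]
  -- For fixed `a`, conjugation by `a` permutes `S` and preserves `k`, so the inner sum does not
  -- depend on `a`.
  have h2 : ∀ a : G, (∑ H with H ∈ S, if J ≤ N (MulAut.conj a • H) then k H else 0) =
      ∑ H with H ∈ S ∧ J ≤ N H, k H := by
    intro a
    rw [← Finset.filter_filter, Finset.sum_filter (p := fun H => J ≤ N H)]
    refine Finset.sum_equiv (MulAction.toPerm (MulAut.conj a)) (fun H => ?_) fun H _ => ?_
    · simp [hS]
    · simp [hk]
  rw [Finset.sum_congr rfl fun a _ => h2 a, Finset.sum_const, Finset.card_univ,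
    ← Nat.card_eq_fintype_card, nsmul_eq_mul, inv_mul_cancel_left₀ hG]

/-- At the mark of `J` only the representative of the class of `J` contributes. -/
theorem eq_finsum_primIdempotent [Finite G] (B : Set (Subgroup G)) (w : Subgroup G → ℚ)
    (hB : ∀ (g : G) (H : Subgroup G), MulAut.conj g • H ∈ B ↔ H ∈ B)
    (hw : ∀ (g : G) (H : Subgroup G), w (MulAut.conj g • H) = w H) (x : BurnsideRing G)
    (hx : ∀ J, J ∈ B → mark J x = w J) (hx' : ∀ J, J ∉ B → mark J x = 0)
    (R : Set (Subgroup G)) (hR : ∀ H : Subgroup G, ∃! K, K ∈ R ∧ ConjSubgroups H K) :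
    x = ∑ᶠ K ∈ {K | K ∈ R ∧ K ∈ B}, w K • primIdempotent K := by
  classical
  have := Fintype.ofFinite (Subgroup G)
  refine sub_eq_zero.1 (eq_zero_of_marks _ fun J => ?_)
  rw [map_sub, sub_eq_zero, finsum_mem_eq_finite_toFinset_sum _ (Set.toFinite _), map_sum]
  obtain ⟨K, ⟨hKR, hJK⟩, huniq⟩ := hR J
  have hzero : ∀ L, L ∈ R → L ≠ K → mark J (w L • primIdempotent L) = 0 := fun L hL hne => by
    rw [map_smul, mark_primIdempotent, if_neg fun h => hne (huniq L ⟨hL, h.symm⟩), smul_zero]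
  have hBK : K ∈ B ↔ J ∈ B := by
    obtain ⟨g, rfl⟩ := hJK
    exact hB g J
  by_cases hJ : J ∈ B
  · rw [Finset.sum_eq_single K]
    · rw [map_smul, mark_primIdempotent, if_pos hJK.symm, hx J hJ]
      obtain ⟨g, rfl⟩ := hJK
      rw [hw, smul_eq_mul, mul_one]
    · intro L hL hne
      exact hzero L ((Set.Finite.mem_toFinset _).1 hL).1 hne
    · intro h
      exact (h ((Set.Finite.mem_toFinset _).2 ⟨hKR, hBK.2 hJ⟩)).elim
  · rw [hx' J hJ, Finset.sum_eq_zero]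
    intro L hL
    obtain ⟨hLR, hLB⟩ := (Set.Finite.mem_toFinset _).1 hL
    exact hzero L hLR fun h => hJ (hBK.1 (h ▸ hLB))

theorem mark_orbit_top [Finite G] (J : Subgroup G) :
    mark J (burnsideClass (orbit (⊤ : Subgroup G))) = 1 := by
  have : fixedCard J (orbit (⊤ : Subgroup G)) = 1 := by
    have := QuotientGroup.subsingleton_quotient_top (G := G)
    rw [fixedCard, Nat.card_eq_one_iff_unique]
    exact ⟨⟨fun _ _ => Subtype.ext (Subsingleton.elim (α := G ⧸ (⊤ : Subgroup G)) _ _)⟩,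
      ⟨⟨((1 : G) : G ⧸ (⊤ : Subgroup G)), fun _ _ =>
        Subsingleton.elim (α := G ⧸ (⊤ : Subgroup G)) _ _⟩⟩⟩
  rw [mark_burnsideClass, this, Nat.cast_one]

end Marks
-- The Lefschetz invariant of a preorder of subgroups
section Main

variable {G : Type u} [Group G]

/-- The Lefschetz invariant of a thin `G`-category whose underlying poset consists of the subgroups
in `S`, ordered through `ι`, and in which the object over `H` has stabilizer `N H`. -/
theorem lefschetz_of_subgroup_poset [Finite G] (D : Action Cat.{u, u} G) [Finite D.V]
    [∀ x y : D.V, Finite (x ⟶ y)] [Quiver.IsThin D.V] {T : Type u} [PartialOrder T] [Fintype T]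
    (ι : Subgroup G ≃ T)
    (hι : ∀ (g : G) (H K : Subgroup G), ι H ≤ ι K → ι (MulAut.conj g • H) ≤ ι (MulAut.conj g • K))
    (S : Set (Subgroup G)) (hS : ∀ g : G, ∀ H ∈ S, MulAut.conj g • H ∈ S)
    (N M : Subgroup G → Subgroup G)
    (hN : ∀ (g : G) (H : Subgroup G), N (MulAut.conj g • H) = MulAut.conj g • N H)
    (hM : ∀ (g : G) (H : Subgroup G), M (MulAut.conj g • H) = MulAut.conj g • M H)
    (hNM : ∀ J H, J ≤ N H ↔ ι (M J) ≤ ι H)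
    (c : D.V → Subgroup G) (hcS : ∀ x, c x ∈ S) (hsurj : ∀ H ∈ S, ∃ x, c x = H)
    (hc : ∀ x y : D.V, Nonempty (x ⟶ y) ↔ ι (c x) ≤ ι (c y))
    (hfix : ∀ (x : D.V) (K : Subgroup G),
      (∀ g ∈ K, (D.ρ g).toFunctor.obj x = x) ↔ K ≤ N (c x))
    (k : Subgroup G → ℚ) (hk : IsMobiusWeight (ι.symm ⁻¹' S) fun t => k (ι.symm t)) :
    HasSeriesLefschetz D ∧
    reducedSeriesLefschetz D =
      (∑ᶠ H ∈ S, (k H / ((N H).index : ℚ)) • burnsideClass (orbit (N H))) -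
        burnsideClass (orbit ⊤) ∧
    ∀ R : Set (Subgroup G), (∀ H : Subgroup G, ∃! K, K ∈ R ∧ ConjSubgroups H K) →
      reducedSeriesLefschetz D =
        ∑ᶠ K ∈ {K | K ∈ R ∧ M K ∉ S}, (-k (M K)) • primIdempotent K := by
  classical
  have := Fintype.ofFinite (Subgroup G)
  have hS' : ∀ (g : G) (H : Subgroup G), MulAut.conj g • H ∈ S ↔ H ∈ S := fun g H =>
    ⟨fun h => by simpa using hS g⁻¹ _ h, hS g H⟩
  have hkc : ∀ (g : G) (H : Subgroup G), k (MulAut.conj g • H) = k H := by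
    intro g H
    let φ : T ≃o T :=
      { toEquiv := (ι.symm.trans (MulAction.toPerm (MulAut.conj g))).trans ι
        map_rel_iff' := fun {s t} => by
          refine ⟨fun h => ?_, fun h => hι g _ _ (by simpa using h)⟩
          simpa using hι g⁻¹ _ _ h }
    simpa [φ] using hk.map_orderIso φ (fun t => by simp [φ, hS']) (ι H)
  set L : BurnsideRing G :=
    ∑ H with H ∈ S, (k H / ((N H).index : ℚ)) • burnsideClass (orbit (N H)) with hL
  have hmark : ∀ J, mark J L = ∑ H with H ∈ S ∧ J ≤ N H, k H := fun J =>
    mark_sum_orbit S hS' N hN k hkc J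
  -- By the adjunction `hNM`, the subgroups `H` in `S` with `J ≤ N H` form the part of `S` above `M
  -- J` in the order of `T`.
  have hsum : ∀ J, mark J L =
      ∑ t with ι.symm t ∈ S ∧ ι (M J) ≤ t, k (ι.symm t) := fun J => by
    rw [hmark]
    refine Finset.sum_equiv ι (fun H => ?_) fun H _ => by simp
    simp [hNM]
  have hval : HasValueAtNegOne (simplexSeries D) L := by
    refine hasValueAtNegOne_of_marks _ _ fun K => ?_
    have := ratValue_mark_simplexSeries D (fun x => ι (c x)) hc K
      (fun t => ι.symm t ∈ S ∧ ι (M K) ≤ t)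
      (fun x => by simp [hfix, hNM, hcS])
      (fun t ht => by
        obtain ⟨x, hx⟩ := hsurj _ ht.1
        exact ⟨x, by rw [hx, Equiv.apply_symm_apply]⟩)
      (fun t => k (ι.symm t))
      (fun t ht => by
        rw [← hk.sum_ge (x := t) ht.1]
        refine Finset.sum_congr (Finset.ext fun s => ?_) fun _ _ => rfl
        simp only [Finset.mem_filter, Finset.mem_univ, true_and, Set.mem_preimage]
        exact ⟨fun h => ⟨h.1.1, h.2⟩, fun h => ⟨⟨h.1, ht.2.trans h.2⟩, h.2⟩⟩)
    rwa [← hsum] at this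
  have hred : reducedSeriesLefschetz D = L - burnsideClass (orbit ⊤) := by
    rw [reducedSeriesLefschetz, hval.seriesLefschetz_eq]
  refine ⟨⟨L, hval⟩, ?_, fun R hR => ?_⟩
  · rw [hred, finsum_mem_eq_finite_toFinset_sum _ (Set.toFinite _), hL]
    congr 1
    exact Finset.sum_congr (by ext; simp) fun _ _ => rfl
  · refine eq_finsum_primIdempotent {K | M K ∉ S} (fun K => -k (M K)) (fun g H => ?_)
      (fun g H => ?_) _ (fun J hJ => ?_) (fun J hJ => ?_) R hR
    · simp [hM, hS']
    · simp [hM, hkc]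
    -- Here `M J ∉ S`: the mark is `1 - k (M J)`, and `[G/G]` removes the 1.
    · have h1 := hk.sum_ge_of_notMem (x := ι (M J)) (by simpa using hJ)
      rw [hred, map_sub, mark_orbit_top, hsum, ← Equiv.symm_apply_apply ι (M J)]
      simp only [Set.mem_preimage] at h1
      rw [Equiv.symm_apply_apply] at h1 ⊢
      rw [h1]; ring
    -- Here `M J ∈ S` is the least element, so the mark is 1 and cancels against `[G/G]`.
    · have h1 := hk.sum_ge (x := ι (M J)) (by simpa using hJ)
      rw [hred, map_sub, mark_orbit_top, hsum]
      simp only [Set.mem_preimage] at h1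
      rw [h1, sub_self]

theorem hom_grothendieck_ext {C : Type u} [Category.{u} C] {F : C ⥤ FinGSet G}
    {p q : (grothendieck F).V} {f g : p ⟶ q}
    (h : (Subtype.val (show {φ : p.1 ⟶ q.1 // ((F ⋙ forgetGSet G).map φ) p.2 = q.2} from f)) =
      Subtype.val (show {φ : p.1 ⟶ q.1 // ((F ⋙ forgetGSet G).map φ) p.2 = q.2} from g)) :
    f = g :=
  Subtype.ext h

/-! ### The subgroup decomposition -/

/-- By transitivity one value determines a `G`-map; this makes `EO` thin. -/
theorem mulActionHom_quotient_ext {H : Subgroup G} {X : Type*} [MulAction G X]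
    {f f' : G ⧸ H →[G] X} {x : G ⧸ H} (h : f x = f' x) : f = f' := by
  refine MulActionHom.ext fun z => ?_
  obtain ⟨a, rfl⟩ := MulAction.exists_smul_eq G x z
  rw [map_smul, map_smul, h]

theorem subgroupDecomposition_isThin [Finite G] (S : Set (Subgroup G)) :
    Quiver.IsThin (subgroupDecomposition S).V := by
  rintro ⟨H, x⟩ ⟨K, y⟩
  refine ⟨fun f g => hom_grothendieck_ext (InducedCategory.hom_ext ?_)⟩
  exact mulActionHom_quotient_ext (x := (show G ⧸ H.1 from x)) (Eq.trans f.2 g.2.symm)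

/-- The rule `g • x ↦ g • y` is well defined because the stabilizer of `x` fixes `y`. With `x = aH`,
the base coset must go to `a⁻¹ • y`. -/
theorem exists_mulActionHom_quotient (H : Subgroup G) {X : Type*} [MulAction G X]
    (x : G ⧸ H) (y : X) (h : MulAction.stabilizer G x ≤ MulAction.stabilizer G y) :
    ∃ f : G ⧸ H →[G] X, f x = y := by
  obtain ⟨a, rfl⟩ := QuotientGroup.mk_surjective x
  have hH : ∀ g ∈ H, g • a⁻¹ • y = a⁻¹ • y := fun g hg => by
    have : a * g * a⁻¹ ∈ MulAction.stabilizer G y := h (by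
      rw [MulAction.mem_stabilizer_iff, MulAction.Quotient.smul_coe, eq_comm, QuotientGroup.eq]
      simpa [mul_assoc] using hg)
    rw [MulAction.mem_stabilizer_iff, mul_smul, mul_smul] at this
    exact (inv_smul_eq_iff.2 this.symm).symm
  refine ⟨{ toFun := Quotient.lift (fun g : G => g • a⁻¹ • y) fun b d hbd => ?_
            map_smul' := ?_ }, smul_inv_smul a y⟩
  · have := hH _ (QuotientGroup.leftRel_apply.1 hbd)
    rw [mul_smul, inv_smul_eq_iff] at this
    exact this.symm
  · rintro g ⟨b⟩
    exact mul_smul g b _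

theorem stabilizer_le_of_mulActionHom {X Y : Type*} [MulAction G X] [MulAction G Y]
    (f : X →[G] Y) {x : X} {y : Y} (h : f x = y) :
    MulAction.stabilizer G x ≤ MulAction.stabilizer G y := fun g hg => by
  rw [MulAction.mem_stabilizer_iff] at hg ⊢
  rw [← h, ← map_smul, hg]

theorem subgroupDecomposition_nonempty_hom [Finite G] (S : Set (Subgroup G))
    (p q : (subgroupDecomposition S).V) :
    Nonempty (p ⟶ q) ↔ MulAction.stabilizer G (show G ⧸ p.1.1 from p.2) ≤
      MulAction.stabilizer G (show G ⧸ q.1.1 from q.2) := by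
  obtain ⟨H, x⟩ := p
  obtain ⟨K, y⟩ := q
  constructor
  · rintro ⟨f⟩
    exact stabilizer_le_of_mulActionHom (show G ⧸ H.1 →[G] G ⧸ K.1 from f.1.hom) f.2
  · intro h
    obtain ⟨f, hf⟩ := exists_mulActionHom_quotient H.1 (show G ⧸ H.1 from x)
      (show G ⧸ K.1 from y) h
    exact ⟨⟨⟨f⟩, hf⟩⟩

theorem grothendieck_obj_eq_iff {C : Type u} [Category.{u} C] (F : C ⥤ FinGSet G)
    (p : (grothendieck F).V) (g : G) :
    ((grothendieck F).ρ g).toFunctor.obj p = p ↔ g • (show F.obj p.1 from p.2) = p.2 := by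
  obtain ⟨x, a⟩ := p
  constructor
  · intro h
    exact eq_of_heq (Sigma.mk.inj_iff.1 h).2
  · intro h
    exact Sigma.ext rfl (heq_of_eq h)

theorem stabilizer_quotient_mk (H : Subgroup G) (a : G) :
    MulAction.stabilizer G (a : G ⧸ H) = MulAut.conj a • H := by
  ext g
  rw [MulAction.mem_stabilizer_iff, mem_conj_smul, eq_comm, MulAction.Quotient.smul_coe,
    QuotientGroup.eq, smul_eq_mul, mul_assoc]

/-! ### The centralizer decomposition -/

theorem centralizer_conj (g : G) (H : Subgroup G) :
    Subgroup.centralizer ((MulAut.conj g • H : Subgroup G) : Set G) =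
      MulAut.conj g • Subgroup.centralizer (H : Set G) := by
  ext x
  rw [mem_conj_smul, Subgroup.mem_centralizer_iff, Subgroup.mem_centralizer_iff]
  constructor
  · intro h y hy
    have := h (g * y * g⁻¹) (mem_conj_smul.2 (by simpa [mul_assoc] using hy))
    calc y * (g⁻¹ * x * g) = g⁻¹ * ((g * y * g⁻¹) * x) * g := by group
      _ = (g⁻¹ * x * g) * y := by rw [this]; group
  · intro h y hy
    have := h _ (mem_conj_smul.1 hy)
    calc y * x = g * ((g⁻¹ * y * g) * (g⁻¹ * x * g)) * g⁻¹ := by group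
      _ = x * y := by rw [this]; group

theorem conj_smul_eq_of_mem_centralizer {K : Subgroup G} {g : G}
    (hg : g ∈ Subgroup.centralizer (K : Set G)) : MulAut.conj g • K = K := by
  have key : ∀ x ∈ K, g⁻¹ * x * g = x := fun x hx => by
    rw [mul_assoc, Subgroup.mem_centralizer_iff.1 hg x hx, inv_mul_cancel_left]
  have key' : ∀ x ∈ K, g * x * g⁻¹ = x := fun x hx => by
    rw [← Subgroup.mem_centralizer_iff.1 hg x hx, mul_inv_cancel_right]
  ext x
  rw [mem_conj_smul]
  refine ⟨fun h => ?_, fun h => (key x h).symm ▸ h⟩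
  have := key' _ h
  rw [show g * (g⁻¹ * x * g) * g⁻¹ = x by group] at this
  rwa [← this] at h

/-- The subgroup `a K a⁻¹` attached to a coset `a C_G(K)`. -/
def conjOfCentralizerCoset (K : Subgroup G) :
    G ⧸ Subgroup.centralizer (K : Set G) → Subgroup G :=
  Quotient.lift (fun a : G => MulAut.conj a • K) fun a b hab => by
    have := conj_smul_eq_of_mem_centralizer (QuotientGroup.leftRel_apply.1 hab)
    rw [map_mul, mul_smul, map_inv, inv_smul_eq_iff] at this
    exact this.symm

theorem conjOfCentralizerCoset_mk (K : Subgroup G) (a : G) :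
    conjOfCentralizerCoset K (a : G ⧸ Subgroup.centralizer (K : Set G)) = MulAut.conj a • K :=
  rfl

/-- The stabilizer of `a C_G(K)` is `a C_G(K) a⁻¹ = C_G(a K a⁻¹)`. -/
theorem le_centralizer_conjOfCentralizerCoset (J K : Subgroup G)
    (x : G ⧸ Subgroup.centralizer (K : Set G)) :
    (∀ g ∈ J, g • x = x) ↔
      J ≤ Subgroup.centralizer (conjOfCentralizerCoset K x : Set G) := by
  obtain ⟨a, rfl⟩ := QuotientGroup.mk_surjective x
  rw [conjOfCentralizerCoset_mk, centralizer_conj, ← stabilizer_quotient_mk]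
  rfl

variable [Finite G] {S : Set (Subgroup G)}

/-- If conjugating elements `g`, `g'` send `a C_G(K)` to the same coset, then `g⁻¹ g'` centralizes
`L`, so they induce the same homomorphism on `L`. This makes `EA` thin. -/
theorem fusionHom_ext_of_centralizerMap {L K : FusionCategory S} {f f' : L ⟶ K}
    {x : G ⧸ Subgroup.centralizer (K.grp : Set G)}
    (h : (show (G ⧸ Subgroup.centralizer (K.grp : Set G)) →[G]
        (G ⧸ Subgroup.centralizer (L.grp : Set G)) from centralizerMap f) x =
      (show (G ⧸ Subgroup.centralizer (K.grp : Set G)) →[G]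
        (G ⧸ Subgroup.centralizer (L.grp : Set G)) from centralizerMap f') x) : f = f' := by
  obtain ⟨a, rfl⟩ := QuotientGroup.mk_surjective x
  obtain ⟨g, hg⟩ := f.exists_conj
  obtain ⟨g', hg'⟩ := f'.exists_conj
  rw [centralizerMap_mk f hg, centralizerMap_mk f' hg', QuotientGroup.eq] at h
  refine FusionCategory.Hom.ext (MonoidHom.ext fun y => Subtype.ext ?_)
  rw [hg, hg']
  have := Subgroup.mem_centralizer_iff.1 h y y.2
  calc g * (y : G) * g⁻¹ = g * (y * ((a * g)⁻¹ * (a * g'))) * g'⁻¹ := by group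
    _ = g' * y * g'⁻¹ := by rw [this]; group

/-- For `x = a C_G(K)` and `y = b C_G(L)`, the only candidate is conjugation by `a⁻¹ b`, which maps
`L` into `K` exactly when `b L b⁻¹ ≤ a K a⁻¹`. -/
theorem exists_centralizerMap_eq_iff {L K : FusionCategory S}
    (x : G ⧸ Subgroup.centralizer (K.grp : Set G))
    (y : G ⧸ Subgroup.centralizer (L.grp : Set G)) :
    (∃ f : L ⟶ K, (show (G ⧸ Subgroup.centralizer (K.grp : Set G)) →[G]
        (G ⧸ Subgroup.centralizer (L.grp : Set G)) from centralizerMap f) x = y) ↔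
      conjOfCentralizerCoset L.grp y ≤ conjOfCentralizerCoset K.grp x := by
  obtain ⟨a, rfl⟩ := QuotientGroup.mk_surjective x
  constructor
  · rintro ⟨f, rfl⟩ z hz
    obtain ⟨g, hg⟩ := f.exists_conj
    rw [centralizerMap_mk f hg, conjOfCentralizerCoset_mk, mem_conj_smul] at hz
    rw [conjOfCentralizerCoset_mk, mem_conj_smul]
    have h1 := hg ⟨_, hz⟩
    have h2 : a⁻¹ * z * a = (f.hom ⟨_, hz⟩ : G) := by
      rw [h1]; group
    rw [h2]
    exact (f.hom _).2
  · obtain ⟨b, rfl⟩ := QuotientGroup.mk_surjective y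
    intro h
    have hmem : ∀ z : L.grp, (MulAut.conj (a⁻¹ * b)) (z : G) ∈ K.grp := fun z => by
      have h1 := h (show b * z * b⁻¹ ∈ _ from mem_conj_smul.2 (by
        rw [show b⁻¹ * (b * (z : G) * b⁻¹) * b = z by group]; exact z.2))
      rw [conjOfCentralizerCoset_mk, mem_conj_smul] at h1
      rw [MulAut.conj_apply]
      convert h1 using 1
      group
    let f : FusionCategory.Hom L K :=
      ⟨((MulAut.conj (a⁻¹ * b)).toMonoidHom.comp L.grp.subtype).codRestrict K.grp hmem,
        a⁻¹ * b, fun z => rfl⟩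
    refine ⟨f, ?_⟩
    rw [centralizerMap_mk (K := K) (L := L) f (g := a⁻¹ * b) (fun z => rfl), mul_inv_cancel_left]

variable (S)

theorem centralizerDecomposition_isThin : Quiver.IsThin (centralizerDecomposition S).V := by
  rintro ⟨K, x⟩ ⟨L, y⟩
  refine ⟨fun f g => hom_grothendieck_ext (Quiver.Hom.unop_inj ?_)⟩
  exact fusionHom_ext_of_centralizerMap (x := x) (Eq.trans f.2 g.2.symm)

theorem centralizerDecomposition_nonempty_hom (p q : (centralizerDecomposition S).V) :
    Nonempty (p ⟶ q) ↔ conjOfCentralizerCoset q.1.unop.grp q.2 ≤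
      conjOfCentralizerCoset p.1.unop.grp p.2 := by
  obtain ⟨K, x⟩ := p
  obtain ⟨L, y⟩ := q
  refine Iff.trans ?_ (exists_centralizerMap_eq_iff (K := K.unop) (L := L.unop) x y)
  exact ⟨fun ⟨f⟩ => ⟨f.1.unop, f.2⟩, fun ⟨f, hf⟩ => ⟨⟨f.op, hf⟩⟩⟩

end Main
end SeriesLefschetz

theorem mainTheorem7 {G : Type u} [Group G] [Finite G] (S : Set (Subgroup G))
    (hS : ∀ g : G, ∀ H ∈ S, MulAut.conj g • H ∈ S) :
    HasSeriesLefschetz (subgroupDecomposition S) ∧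
    HasSeriesLefschetz (centralizerDecomposition S) ∧
    reducedSeriesLefschetz (subgroupDecomposition S) =
      (∑ᶠ H ∈ S, (-reducedEulerChar (above S H) / (H.index : ℚ)) • burnsideClass (orbit H)) -
        burnsideClass (orbit ⊤) ∧
    reducedSeriesLefschetz (centralizerDecomposition S) =
      (∑ᶠ H ∈ S, (-reducedEulerChar (below S H) /
          ((Subgroup.centralizer (H : Set G)).index : ℚ)) •
            burnsideClass (orbit (Subgroup.centralizer (H : Set G)))) -
        burnsideClass (orbit ⊤) ∧
    ∀ R : Set (Subgroup G), (∀ H : Subgroup G, ∃! K, K ∈ R ∧ ConjSubgroups H K) →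
      reducedSeriesLefschetz (subgroupDecomposition S) =
        ∑ᶠ K ∈ {K | K ∈ R ∧ K ∉ S}, reducedEulerChar (above S K) • primIdempotent K ∧
      reducedSeriesLefschetz (centralizerDecomposition S) =
        ∑ᶠ K ∈ {K | K ∈ R ∧ Subgroup.centralizer (K : Set G) ∉ S},
          reducedEulerChar (below S (Subgroup.centralizer (K : Set G))) • primIdempotent K := by
  have := Fintype.ofFinite (Subgroup G)
  have := subgroupDecomposition_isThin S
  have := centralizerDecomposition_isThin S
  have hmono : ∀ (g : G) (H K : Subgroup G), H ≤ K → MulAut.conj g • H ≤ MulAut.conj g • K :=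
    fun g H K h => Subgroup.pointwise_smul_le_pointwise_smul_iff.2 h
  have hconj : ∀ (H : Subgroup G), H ∈ S → ∀ a : G, MulAut.conj a • H ∈ S := fun H hH a =>
    hS a H hH
  obtain ⟨k, hk⟩ := exists_isMobiusWeight S
  obtain ⟨l, hl⟩ := exists_isMobiusWeight (OrderDual.ofDual ⁻¹' S)
  have hk' : IsMobiusWeight S fun H => -reducedEulerChar (above S H) := by
    convert hk using 1
    exact funext fun H => (hk.eq_above H).symm
  have hl' : IsMobiusWeight (OrderDual.ofDual ⁻¹' S) fun t : (Subgroup G)ᵒᵈ =>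
      -reducedEulerChar (below S (OrderDual.ofDual t)) := by
    convert hl using 1
    exact funext fun H => (hl.eq_below (OrderDual.ofDual H)).symm
  -- For `EO` the order is inclusion, an object lies over its stabilizer, and `N` and `M` are the
  -- identity. The base coset of `G ⧸ H` lies over `H`.
  obtain ⟨hO1, hO2, hO3⟩ := lefschetz_of_subgroup_poset (subgroupDecomposition S)
    (T := Subgroup G) (Equiv.refl _) hmono S hS id id (fun _ _ => rfl) (fun _ _ => rfl)
    (fun _ _ => Iff.rfl) (fun p => MulAction.stabilizer G (show G ⧸ p.1.1 from p.2))
    (by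
      rintro ⟨H, x⟩
      obtain ⟨a, rfl⟩ := QuotientGroup.mk_surjective (show G ⧸ H.1 from x)
      exact (stabilizer_quotient_mk H.1 a).symm ▸ hconj _ H.2 a)
    (fun H hH => ⟨⟨⟨H, hH⟩, ((1 : G) : G ⧸ H)⟩,
      (stabilizer_quotient_mk H 1).trans (by rw [map_one, one_smul])⟩)
    (subgroupDecomposition_nonempty_hom S)
    (fun p K => forall₂_congr fun g _ => grothendieck_obj_eq_iff _ p g)
    (fun H => -reducedEulerChar (above S H)) hk'
  -- For `EA` the order is reversed, and `N = M = C_G`: taking centralizers is a Galois connection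
  -- with itself.
  obtain ⟨hA1, hA2, hA3⟩ := lefschetz_of_subgroup_poset (centralizerDecomposition S)
    (T := (Subgroup G)ᵒᵈ) OrderDual.toDual (fun g H K h => hmono g K H h) S hS
    (fun H => Subgroup.centralizer (H : Set G)) (fun H => Subgroup.centralizer (H : Set G))
    centralizer_conj centralizer_conj (fun _ _ => Subgroup.le_centralizer_iff)
    (fun p => conjOfCentralizerCoset p.1.unop.grp p.2)
    (by
      rintro ⟨⟨H⟩, x⟩
      obtain ⟨a, rfl⟩ := QuotientGroup.mk_surjective
        (show G ⧸ Subgroup.centralizer (H.grp : Set G) from x)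
      exact hconj _ H.mem a)
    (fun H hH => ⟨⟨⟨⟨H, hH⟩⟩, ((1 : G) : G ⧸ Subgroup.centralizer (H : Set G))⟩,
      (conjOfCentralizerCoset_mk H 1).trans (by rw [map_one, one_smul])⟩)
    (centralizerDecomposition_nonempty_hom S)
    (fun p K => (forall₂_congr fun g _ => grothendieck_obj_eq_iff _ p g).trans
      (le_centralizer_conjOfCentralizerCoset K p.1.unop.grp p.2))
    (fun H => -reducedEulerChar (below S H)) hl'
  refine ⟨hO1, hA1, hO2, hA2, fun R hR => ⟨?_, ?_⟩⟩
  · simpa only [neg_neg, id] using hO3 R hR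
  · simpa only [neg_neg] using hA3 R hR
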